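/- Let $\mathbb F_\beta=\mathbb R,\mathbb C,\mathbb H$ for $\beta=1,2,4$ respectively, with $|a|^2=\bar a a$, and regard $\mathbb F_\beta^n$ as a right vector space over $\mathbb F_\beta$ (this matters only for $\beta=4$) with Hermitian form $\langle x,y\rangle=\sum_i\bar x_iy_i$; $d\mathbf v$ denotes Lebesgue measure on $\mathbb F_\beta^n\cong\mathbb R^{\beta n}$. Let $0\le N\le n$, let $G^\beta_{N,n}$ be the Grassmannian of $N$-dimensional subspaces of $\mathbb F_\beta^n$, and let $d\omega^\beta_{N,n}$ be its invariant measure under the unitary group of $\mathbb F_\beta^n$, normalised to have total mass $$\prod_{i=1}^N\frac{\sigma_{\beta(n-i+1)}}{\sigma_{\beta(N-i+1)}},\qquad \sigma_l=\frac{2\pi^{l/2}}{\Gamma(l/2)} .$$ For $L\in G^\beta_{N,n}$ let $B_L$ be any $n\times N$ matrix with entries in $\mathbb F_\beta$ whose columns form an orthonormal basis of $L$, and let $dS^{\perp,\beta}_{n-N}$ be Lebesgue measure on the Euclidean space $L^\perp$. For a square real or complex matrix, $|\det M|$ has its usual meaning; for a quaternion matrix, $|\det M|$ is the product of the singular values of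 $M$, i.e. the square root of the modulus of the determinant of the complex matrix obtained by replacing each entry $z+wj$ by $\begin{bmatrix}z&w\\-\bar w&\bar z\end{bmatrix}$. Then, writing $N+1$ points of $\mathbb F_\beta^n$ as $\mathbf v_k^n=B_L\mathbf v_k^N+\mathbf r$ with $\mathbf v_k^N\in\mathbb F_\beta^N$, $k=0,\dots,N$, and $\mathbf r\in L^\perp$, one has $$\prod_{k=0}^N d\mathbf v_k^n=\bigl|\det[\mathbf v_k^N-\mathbf v_0^N]_{k=1}^N\bigr|^{\beta(n-N)}\prod_{k=0}^N d\mathbf v_k^N\;d\omega^\beta_{N,n}\;dS^{\perp,\beta}_{n-N},$$ that is, for every measurable $f:(\mathbb F_\beta^n)^{N+1}\to[0,\infty]$ and every choice of the bases $B_L$, $$\int f(\mathbf v_0,\dots,\mathbf v_N)\prod_{k=0}^N d\mathbf v_k=\int_{G^\beta_{N,n}}d\omega^\beta_{N,n}(L)\int_{L^\perp}dS^{\perp,\beta}_{n-N}(\mathbf r)\int_{(\mathbb F_\beta^N)^{N+1}}\prod_{k=0}^N d\mathbf w_k\;\bigl|\det[\mathbf w_k-\mathbf w_0]_{k=1}^N\bigr|^{\beta(n-N)}f(B_L\mathbf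 w_0+\mathbf r,\dots,B_L\mathbf w_N+\mathbf r).$$ -/

import Mathlib

open MeasureTheory Matrix
open scoped ENNReal Quaternion

/-- Lebesgue measure on the quaternions is the one of the Euclidean space `ℍ ≅ ℝ⁴`; it comes from
the real inner product structure once the Borel sets are in place. -/
noncomputable instance Quaternion.borelMeasurableSpace : MeasurableSpace ℍ[ℝ] := borel ℍ[ℝ]

instance Quaternion.borelBorelSpace : BorelSpace ℍ[ℝ] := ⟨rfl⟩

namespace BlaschkePetkantschin

/-- The relation `\bar a a = |a|²` between conjugation and norm, valid in `ℝ`, `ℂ` and `ℍ`. -/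
class NormedStar (𝔽 : Type) [NormedDivisionRing 𝔽] [StarRing 𝔽] [InnerProductSpace ℝ 𝔽] :
    Prop where
  star_mul_self' : ∀ a : 𝔽, star a * a = (‖a‖ ^ 2 : ℝ) • (1 : 𝔽)

instance : NormedStar ℝ where
  star_mul_self' a := by simp [sq]

instance : NormedStar ℂ where
  star_mul_self' a := by
    simp only [Complex.star_def, Complex.conj_mul', Complex.real_smul, mul_one]
    push_cast
    rfl

instance : NormedStar ℍ[ℝ] where
  star_mul_self' a := by
    rw [Quaternion.star_mul_self, Quaternion.normSq_eq_norm_mul_self, ← sq]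
    rw [← Algebra.algebraMap_eq_smul_one, Quaternion.algebraMap_def]

noncomputable section

section Scalars

set_option linter.unusedSectionVars false

variable {𝔽 : Type} [NormedDivisionRing 𝔽] [StarRing 𝔽] [InnerProductSpace ℝ 𝔽]
  [SMulCommClass ℝ 𝔽 𝔽] [IsScalarTower ℝ 𝔽 𝔽]

variable (𝔽) in
/-- The Stiefel manifold: `n × N` matrices over `𝔽` with orthonormal columns. -/
def Stiefel (N n : ℕ) : Type :=
  {A : Matrix (Fin n) (Fin N) 𝔽 // Aᴴ * A = 1}

instance (N n : ℕ) : TopologicalSpace (Stiefel 𝔽 N n) :=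
  inferInstanceAs (TopologicalSpace {A : Matrix (Fin n) (Fin N) 𝔽 // Aᴴ * A = 1})

instance (N n : ℕ) : MeasurableSpace (Stiefel 𝔽 N n) := borel _

instance (N n : ℕ) : BorelSpace (Stiefel 𝔽 N n) := ⟨rfl⟩

/-- The map `w ↦ A w` from `𝔽^N` to `𝔽^n`. Scalars act on vectors from the right, so that matrices
act linearly from the left also when `𝔽` is not commutative. -/
def Stiefel.toLin {N n : ℕ} (A : Stiefel 𝔽 N n) :
    EuclideanSpace 𝔽 (Fin N) →ₗ[𝔽ᵐᵒᵖ] EuclideanSpace 𝔽 (Fin n) where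
  toFun w := WithLp.toLp 2 (A.1 *ᵥ w.ofLp)
  map_add' v w := by
    ext i
    simp [Matrix.mulVec_add]
  map_smul' c w := by
    ext i
    simp [Matrix.mulVec, dotProduct, Finset.sum_mul, mul_assoc]

theorem Stiefel.conjTranspose_mulVec_toLin {N n : ℕ} (A : Stiefel 𝔽 N n)
    (w : EuclideanSpace 𝔽 (Fin N)) : A.1ᴴ *ᵥ (A.toLin w).ofLp = w.ofLp := by
  simp [Stiefel.toLin, Matrix.mulVec_mulVec, A.2]

theorem Stiefel.toLin_injective {N n : ℕ} (A : Stiefel 𝔽 N n) :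
    Function.Injective A.toLin := fun v w h => by
  have := congrArg (fun x => A.1ᴴ *ᵥ x.ofLp) h
  simp only [conjTranspose_mulVec_toLin] at this
  exact WithLp.ofLp_injective 2 this

variable (𝔽) in
/-- Coordinates of `𝔽^N` as a right vector space. -/
def coordEquiv (N : ℕ) : (Fin N → 𝔽ᵐᵒᵖ) ≃ₗ[𝔽ᵐᵒᵖ] EuclideanSpace 𝔽 (Fin N) where
  toFun x := WithLp.toLp 2 fun i => (x i).unop
  invFun v i := MulOpposite.op (v i)
  map_add' _ _ := rfl
  map_smul' _ _ := rfl
  left_inv _ := rfl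
  right_inv _ := rfl

theorem finrank_euclideanSpace_op (N : ℕ) :
    Module.finrank 𝔽ᵐᵒᵖ (EuclideanSpace 𝔽 (Fin N)) = N := by
  rw [← (coordEquiv 𝔽 N).finrank_eq, Module.finrank_fin_fun]

variable (𝔽) in
/-- The Grassmannian: `N`-dimensional (right) subspaces of `𝔽^n`. -/
def Grassmannian (N n : ℕ) : Type :=
  {L : Submodule 𝔽ᵐᵒᵖ (EuclideanSpace 𝔽 (Fin n)) // Module.finrank 𝔽ᵐᵒᵖ L = N}

/-- The column space of a matrix with orthonormal columns. -/
def colSpan {N n : ℕ} (A : Stiefel 𝔽 N n) : Grassmannian 𝔽 N n :=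
  ⟨LinearMap.range A.toLin, by
    rw [LinearMap.finrank_range_of_inj A.toLin_injective, finrank_euclideanSpace_op]⟩

theorem star_real_smul [NormedStar 𝔽] (t : ℝ) (y : 𝔽) : star (t • y) = t • star y := by
  have h1 : star (t • (1 : 𝔽)) = t • 1 := by
    by_cases ht : t = 0
    · simp [ht]
    · have h := NormedStar.star_mul_self' (t • (1 : 𝔽))
      rw [mul_smul_comm, mul_one, norm_smul, norm_one, mul_one, Real.norm_eq_abs, sq_abs, sq,
        mul_smul] at h
      exact smul_right_injective 𝔽 ht h
  have h2 : t • y = (t • (1 : 𝔽)) * y := by rw [smul_mul_assoc, one_mul]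
  rw [h2, star_mul, h1, mul_smul_comm, mul_one]

/-- Every `N`-dimensional subspace has an orthonormal basis. -/
theorem colSpan_surjective [NormedStar 𝔽] {N n : ℕ} :
    Function.Surjective (colSpan : Stiefel 𝔽 N n → Grassmannian 𝔽 N n) := by
  rintro ⟨L, hL⟩
  have hfd : FiniteDimensional 𝔽ᵐᵒᵖ (EuclideanSpace 𝔽 (Fin n)) :=
    Module.Finite.equiv (coordEquiv 𝔽 n)
  have key : ∀ k ≤ N, ∃ A : Stiefel 𝔽 k n, LinearMap.range A.toLin ≤ L := by
    intro k
    induction k with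
    | zero =>
      intro _
      refine ⟨⟨0, by ext i; exact i.elim0⟩, ?_⟩
      rintro _ ⟨w, rfl⟩
      have : w = 0 := Subsingleton.elim _ _
      rw [this, map_zero]; exact L.zero_mem
    | succ k ih =>
      intro hk
      obtain ⟨A, hA⟩ := ih (by omega)
      have hlt : ¬ L ≤ LinearMap.range A.toLin := by
        intro hle
        have := Submodule.finrank_mono hle
        rw [LinearMap.finrank_range_of_inj A.toLin_injective, finrank_euclideanSpace_op] at this
        omega
      obtain ⟨x, hxL, hx⟩ := SetLike.not_le_iff_exists.1 hlt
      set c : EuclideanSpace 𝔽 (Fin k) := WithLp.toLp 2 (A.1ᴴ *ᵥ x.ofLp) with hc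
      set y := x - A.toLin c with hy
      have hyL : y ∈ L := L.sub_mem hxL (hA ⟨c, rfl⟩)
      have hy0 : y ≠ 0 := fun h => hx ⟨c, (sub_eq_zero.1 h).symm⟩
      have hAy : A.1ᴴ *ᵥ y.ofLp = 0 := by
        have : y.ofLp = x.ofLp - (A.toLin c).ofLp := rfl
        rw [this, Matrix.mulVec_sub, A.conjTranspose_mulVec_toLin]; simp [hc]
      set s : ℝ := ∑ i, ‖y i‖ ^ 2 with hs
      have hs0 : 0 < s := by
        have hne : ∃ i, y i ≠ 0 := by
          by_contra! h
          exact hy0 (by ext i; exact h i)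
        obtain ⟨i, hi⟩ := hne
        exact Finset.sum_pos' (fun _ _ => sq_nonneg _) ⟨i, Finset.mem_univ _, by positivity⟩
      have hss : ∑ i, star (y i) * y i = s • (1 : 𝔽) := by
        simp [NormedStar.star_mul_self', ← Finset.sum_smul, hs]
      set t : ℝ := (Real.sqrt s)⁻¹
      have ht : t * t * s = 1 := by
        have := Real.mul_self_sqrt hs0.le
        have h0 : Real.sqrt s ≠ 0 := (Real.sqrt_pos.2 hs0).ne'
        simp only [t]; field_simp; nlinarith
      let C : Matrix (Fin n) (Fin (k + 1)) 𝔽 := Matrix.of fun i j =>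
        Fin.lastCases (t • y i) (fun j => A.1 i j) j
      have hAy' : ∀ j, ∑ i, star (A.1 i j) * y i = 0 := fun j => by
        simpa [Matrix.mulVec, dotProduct] using congrFun hAy j
      have hyA : ∀ j, ∑ i, star (y i) * A.1 i j = 0 := fun j => by
        have := congrArg star (hAy' j)
        simpa [star_sum] using this
      have hC : Cᴴ * C = 1 := by
        ext a b
        rw [Matrix.mul_apply]
        refine Fin.lastCases ?_ (fun a => ?_) a <;> refine Fin.lastCases ?_ (fun b => ?_) b
        · simp only [C, Matrix.conjTranspose_apply, Matrix.of_apply, Fin.lastCases_last, star_real_smul,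
            smul_mul_smul_comm]
          rw [← Finset.smul_sum, hss, smul_smul, ht]; simp
        · simp only [C, Matrix.conjTranspose_apply, Matrix.of_apply, Fin.lastCases_last, Fin.lastCases_castSucc,
            star_real_smul, smul_mul_assoc]
          rw [← Finset.smul_sum, hyA]; simp [(Fin.castSucc_lt_last b).ne']
        · simp only [C, Matrix.conjTranspose_apply, Matrix.of_apply, Fin.lastCases_last, Fin.lastCases_castSucc,
            mul_smul_comm]
          rw [← Finset.smul_sum, hAy']; simp [(Fin.castSucc_lt_last a).ne]
        · have := congrFun (congrFun A.2 a) b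
          rw [Matrix.mul_apply] at this
          simp only [C, Matrix.conjTranspose_apply, Matrix.of_apply, Fin.lastCases_castSucc]
          simpa [Matrix.one_apply] using this
      refine ⟨⟨C, hC⟩, ?_⟩
      rintro _ ⟨w, rfl⟩
      have : Stiefel.toLin ⟨C, hC⟩ w =
          A.toLin (WithLp.toLp 2 fun j => w j.castSucc) +
            MulOpposite.op (t • w (Fin.last k)) • y := by
        ext i
        simp [Stiefel.toLin, Matrix.mulVec, dotProduct, Fin.sum_univ_castSucc, C, smul_mul_assoc]
      rw [this]
      exact L.add_mem (hA ⟨_, rfl⟩) (L.smul_mem _ hyL)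
  obtain ⟨A, hA⟩ := key N le_rfl
  refine ⟨A, Subtype.ext (Submodule.eq_of_le_of_finrank_eq hA ?_)⟩
  change Module.finrank 𝔽ᵐᵒᵖ (LinearMap.range A.toLin) = Module.finrank 𝔽ᵐᵒᵖ L
  rw [LinearMap.finrank_range_of_inj A.toLin_injective, finrank_euclideanSpace_op, hL]

/-- The Grassmannian is the quotient of the Stiefel manifold by `colSpan`, and it carries the
quotient `σ`-algebra. -/
instance (N n : ℕ) : MeasurableSpace (Grassmannian 𝔽 N n) :=
  MeasurableSpace.map colSpan inferInstance

/-- The orthogonal complement for the Hermitian form `∑ i, \bar x_i y_i`, as a real Euclidean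
space. -/
def perp {N n : ℕ} (L : Grassmannian 𝔽 N n) : Submodule ℝ (EuclideanSpace 𝔽 (Fin n)) where
  carrier := {r | ∀ x ∈ L.1, ∑ i, star (x i) * r i = 0}
  add_mem' := by
    intro a b ha hb x hx
    simp [mul_add, Finset.sum_add_distrib, ha x hx, hb x hx]
  zero_mem' := by
    intro x _
    simp
  smul_mem' := by
    intro c a ha x hx
    simp [mul_smul_comm, ← Finset.smul_sum, ha x hx]

/-- The unitary group of `𝔽^n` (orthogonal, unitary or symplectic). -/
abbrev UnitaryGroup (𝔽 : Type) [NormedDivisionRing 𝔽] [StarRing 𝔽] (n : ℕ) : Type :=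
  unitary (Matrix (Fin n) (Fin n) 𝔽)

instance [FiniteDimensional ℝ 𝔽] [ContinuousStar 𝔽] [NormedStar 𝔽] (n : ℕ) :
    CompactSpace (UnitaryGroup 𝔽 n) := by
  have : ProperSpace 𝔽 := FiniteDimensional.proper ℝ 𝔽
  let S : Set (Matrix (Fin n) (Fin n) 𝔽) := Set.univ.pi fun _ : Fin n =>
    Set.univ.pi fun _ : Fin n => Metric.closedBall (0 : 𝔽) 1
  have hc : IsCompact S :=
    isCompact_univ_pi fun _ => isCompact_univ_pi fun _ => isCompact_closedBall 0 1
  have hcl : IsClosed (unitary (Matrix (Fin n) (Fin n) 𝔽) : Set (Matrix (Fin n) (Fin n) 𝔽)) :=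
    isClosed_unitary
  refine isCompact_iff_compactSpace.1 (hc.of_isClosed_subset hcl ?_)
  intro U hU i _ j _
  have h1 := congrFun (congrFun (Unitary.mem_iff.1 hU).1 j) j
  rw [Matrix.mul_apply, Matrix.one_apply_eq] at h1
  simp only [Matrix.star_apply, NormedStar.star_mul_self', ← Finset.sum_smul] at h1
  have h2 : ∑ k, ‖U k j‖ ^ 2 = 1 := by
    refine smul_left_injective ℝ (one_ne_zero (α := 𝔽)) ?_
    simpa using h1
  have h3 : ‖U i j‖ ^ 2 ≤ 1 :=
    h2 ▸ Finset.single_le_sum (f := fun k => ‖U k j‖ ^ 2) (fun _ _ => sq_nonneg _)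
      (Finset.mem_univ i)
  simpa using (sq_le_one_iff₀ (norm_nonneg _)).1 h3

instance (n : ℕ) : MeasurableSpace (UnitaryGroup 𝔽 n) := borel _

instance (n : ℕ) : BorelSpace (UnitaryGroup 𝔽 n) := ⟨rfl⟩

/-- The first `N` columns of a unitary matrix. -/
def frame {N n : ℕ} (h : N ≤ n) (U : UnitaryGroup 𝔽 n) : Stiefel 𝔽 N n :=
  ⟨U.1.submatrix id (Fin.castLE h), by
    have hU : U.1ᴴ * U.1 = 1 := (Unitary.mem_iff.1 U.2).1
    have : (U.1.submatrix id (Fin.castLE h))ᴴ * U.1.submatrix id (Fin.castLE h) =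
        (U.1ᴴ * U.1).submatrix (Fin.castLE h) (Fin.castLE h) := by
      ext i j
      simp [Matrix.mul_apply]
    rw [this, hU, Matrix.submatrix_one _ (Fin.castLE_injective h)]⟩

/-- The surface area `2 π^{l/2} / Γ(l/2)` of the unit sphere in `ℝ^l`. -/
def sphereArea (l : ℕ) : ℝ :=
  2 * Real.pi ^ ((l : ℝ) / 2) / Real.Gamma ((l : ℝ) / 2)

variable (𝔽) in
/-- The total mass `∏_{i=1}^N σ_{β(n-i+1)}` of the invariant measure on the Stiefel manifold, where
`β = dim_ℝ 𝔽`. -/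
def stiefelVolume (N n : ℕ) : ℝ≥0∞ :=
  ENNReal.ofReal (∏ i ∈ Finset.Icc 1 N, sphereArea (Module.finrank ℝ 𝔽 * (n - i + 1)))

variable (𝔽) in
/-- The invariant measure `(U₁† dU₁)` on the Stiefel manifold: the image of Haar measure on the
unitary group, normalised to have total mass `stiefelVolume`. -/
def stiefelMeasure [FiniteDimensional ℝ 𝔽] [ContinuousStar 𝔽] [NormedStar 𝔽] {N n : ℕ}
    (h : N ≤ n) : Measure (Stiefel 𝔽 N n) :=
  stiefelVolume 𝔽 N n •
    (Measure.haarMeasure (⊤ : TopologicalSpace.PositiveCompacts (UnitaryGroup 𝔽 n))).map (frame h)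

variable (𝔽) in
/-- The invariant measure `dω` on the Grassmannian, normalised by
`(U₁† dU₁) = dω (U† dU)` with `U` in the Stiefel manifold of square matrices. -/
def grassmannMeasure [FiniteDimensional ℝ 𝔽] [ContinuousStar 𝔽] [NormedStar 𝔽] {N n : ℕ}
    (h : N ≤ n) : Measure (Grassmannian 𝔽 N n) :=
  (stiefelVolume 𝔽 N N)⁻¹ • (stiefelMeasure 𝔽 h).map colSpan

/-- A choice of orthonormal basis for every `N`-dimensional subspace of `𝔽^n`. -/
def IsBasisChoice {N n : ℕ} (B : Grassmannian 𝔽 N n → Stiefel 𝔽 N n) : Prop :=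
  ∀ L, colSpan (B L) = L

theorem exists_isBasisChoice [NormedStar 𝔽] (N n : ℕ) :
    ∃ B : Grassmannian 𝔽 N n → Stiefel 𝔽 N n, IsBasisChoice B :=
  ⟨Function.surjInv colSpan_surjective, Function.surjInv_eq colSpan_surjective⟩

/-- The square matrix with columns `w_k - w_0`, `k = 1, …, N`. -/
def diffMatrix {N : ℕ} (w : Fin (N + 1) → EuclideanSpace 𝔽 (Fin N)) :
    Matrix (Fin N) (Fin N) 𝔽 :=
  Matrix.of fun i k => w k.succ i - w 0 i

end Scalars

/-- The `2 × 2` complex matrix `[z, w; -\bar w, \bar z]` that represents the quaternion `z + w j`. -/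
def quaternionBlock (q : ℍ[ℝ]) : Matrix (Fin 2) (Fin 2) ℂ :=
  !![⟨q.re, q.imI⟩, ⟨q.imJ, q.imK⟩; -star ⟨q.imJ, q.imK⟩, star ⟨q.re, q.imI⟩]

/-- The complex matrix of twice the size that represents a quaternion matrix. -/
def complexRep {N : ℕ} (M : Matrix (Fin N) (Fin N) ℍ[ℝ]) :
    Matrix (Fin N × Fin 2) (Fin N × Fin 2) ℂ :=
  Matrix.of fun p q => quaternionBlock (M p.1 q.1) p.2 q.2

/-- `|det M|` for a quaternion matrix: the product of its singular values. In the complex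
representation every singular value has multiplicity two, hence the square root. -/
def quaternionAbsDet {N : ℕ} (M : Matrix (Fin N) (Fin N) ℍ[ℝ]) : ℝ :=
  Real.sqrt ‖(complexRep M).det‖

end

end BlaschkePetkantschin

open BlaschkePetkantschin

namespace BlaschkePetkantschin

/-! ### Orthonormal frames, orthogonal splitting and unitary extension. -/

section Geometry

set_option linter.unusedSectionVars false

variable {𝔽 : Type} [NormedDivisionRing 𝔽] [StarRing 𝔽] [InnerProductSpace ℝ 𝔽]
  [SMulCommClass ℝ 𝔽 𝔽] [IsScalarTower ℝ 𝔽 𝔽]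

/-! The affine formula reduces to a linear one. With the first vertex `v` and the edges from it as
variables, and with `v = A w₀ + r` sweeping out all of `𝔽^n`, the position of the simplex is
integrated away (`lintegral_perp_diffMatrix`). What remains is a formula for `N` vectors of `𝔽^n` in
terms of `N` vectors of a random `N`-dimensional subspace (`lintegral_eq_lintegral_frame`).

No Jacobian is computed for the linear formula. Averaging over the unitary group changes neither
integral over `(𝔽^n)^N`, so a unitarily invariant integrand `g` suffices. For such `g` the proof is
by induction on the number of vectors (`lintegral_of_isUnitaryInvariant`). The first `N` vectors are
replaced by vectors `T` of `𝔽^N`, at the cost of the weight `D(T)^{β(n-N)}`. The next one splits as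
`a + b` with `a` in `𝔽^N` and `b` orthogonal to it. A rotation fixing `𝔽^N` turns `b` into `‖b‖`
times the next axis, so the integrand is radial in `b`. The same reduction applies inside `𝔽^{N+1}`,
where `b` ranges over real dimension `β` instead of `β(n-N)`. Polar coordinates compare the two
radial integrals (`lintegral_fun_norm_eq`): the price is `σ_{β(n-N)}/σ_β` and a factor
`‖b‖^{β(n-N-1)}`. The constants multiply up to the mass of the Grassmannian. The factor joins part
of `D(T)^{β(n-N)}` to form the required power of the determinant of the block triangular matrix with
columns `T` and `(a, ‖b‖)`.

The three scalar fields are treated together through `IsAbsDet`, which records the few properties of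
`|det|` used here. -/

theorem star_dotProduct_self [NormedStar 𝔽] {n : ℕ} (x : EuclideanSpace 𝔽 (Fin n)) :
    star x.ofLp ⬝ᵥ x.ofLp = (‖x‖ ^ 2 : ℝ) • (1 : 𝔽) := by
  rw [PiLp.norm_sq_eq_of_L2, Finset.sum_smul]
  simp [dotProduct, NormedStar.star_mul_self']

theorem norm_sq_eq_of_star_dotProduct_self [NormedStar 𝔽] {n : ℕ} {x : EuclideanSpace 𝔽 (Fin n)}
    {t : ℝ} (h : star x.ofLp ⬝ᵥ x.ofLp = t • (1 : 𝔽)) : ‖x‖ ^ 2 = t :=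
  smul_left_injective ℝ (one_ne_zero (α := 𝔽)) ((star_dotProduct_self x).symm.trans h)

theorem Stiefel.ofLp_toLin {N n : ℕ} (A : Stiefel 𝔽 N n) (w : EuclideanSpace 𝔽 (Fin N)) :
    (A.toLin w).ofLp = A.1 *ᵥ w.ofLp := rfl

theorem Stiefel.star_dotProduct_toLin {N n : ℕ} (A : Stiefel 𝔽 N n)
    (v w : EuclideanSpace 𝔽 (Fin N)) :
    star (A.toLin v).ofLp ⬝ᵥ (A.toLin w).ofLp = star v.ofLp ⬝ᵥ w.ofLp := by
  rw [A.ofLp_toLin v, A.ofLp_toLin w, Matrix.star_mulVec, ← Matrix.dotProduct_mulVec,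
    Matrix.mulVec_mulVec, A.2, Matrix.one_mulVec]

theorem Stiefel.norm_toLin [NormedStar 𝔽] {N n : ℕ} (A : Stiefel 𝔽 N n)
    (w : EuclideanSpace 𝔽 (Fin N)) : ‖A.toLin w‖ = ‖w‖ := by
  have := norm_sq_eq_of_star_dotProduct_self
    ((A.star_dotProduct_toLin w w).trans (star_dotProduct_self w))
  exact (sq_eq_sq₀ (norm_nonneg _) (norm_nonneg _)).1 this

theorem Stiefel.toLin_real_smul {N n : ℕ} (A : Stiefel 𝔽 N n) (t : ℝ)
    (w : EuclideanSpace 𝔽 (Fin N)) : A.toLin (t • w) = t • A.toLin w := by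
  apply WithLp.ofLp_injective 2
  simp [Stiefel.ofLp_toLin]

theorem mem_perp_colSpan_iff {N n : ℕ} (A : Stiefel 𝔽 N n) (r : EuclideanSpace 𝔽 (Fin n)) :
    r ∈ perp (colSpan A) ↔ A.1ᴴ *ᵥ r.ofLp = 0 := by
  constructor
  · intro hr
    ext j
    have := hr (A.toLin (WithLp.toLp 2 (Pi.single j 1))) ⟨_, rfl⟩
    simpa [Stiefel.toLin, Matrix.mulVec, dotProduct] using this
  · rintro hr _ ⟨w, rfl⟩
    have : star (A.toLin w).ofLp ⬝ᵥ r.ofLp = 0 := by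
      rw [A.ofLp_toLin, Matrix.star_mulVec, ← Matrix.dotProduct_mulVec, hr, dotProduct_zero]
    simpa [dotProduct] using this

theorem norm_toLin_add_sq [NormedStar 𝔽] {N n : ℕ} (A : Stiefel 𝔽 N n)
    (w : EuclideanSpace 𝔽 (Fin N)) (r : EuclideanSpace 𝔽 (Fin n)) (hr : r ∈ perp (colSpan A)) :
    ‖A.toLin w + r‖ ^ 2 = ‖w‖ ^ 2 + ‖r‖ ^ 2 := by
  apply norm_sq_eq_of_star_dotProduct_self
  have h1 : star (A.toLin w).ofLp ⬝ᵥ r.ofLp = 0 := by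
    simpa [dotProduct] using hr _ ⟨w, rfl⟩
  have h2 : star r.ofLp ⬝ᵥ (A.toLin w).ofLp = 0 := by
    have := congrArg star h1
    rwa [Matrix.star_dotProduct, star_star, star_zero] at this
  simp only [WithLp.ofLp_add, star_add, add_dotProduct, dotProduct_add, h1, h2,
    A.star_dotProduct_toLin, star_dotProduct_self, add_smul, add_zero, zero_add]

/-- The orthogonal decomposition of `𝔽^n` along the column space of `A`. -/
noncomputable def Stiefel.decomp [NormedStar 𝔽] {N n : ℕ} (A : Stiefel 𝔽 N n) :
    WithLp 2 (EuclideanSpace 𝔽 (Fin N) × perp (colSpan A)) ≃ₗᵢ[ℝ] EuclideanSpace 𝔽 (Fin n) where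
  toFun p := A.toLin p.fst + p.snd
  invFun v := WithLp.toLp 2 (WithLp.toLp 2 (A.1ᴴ *ᵥ v.ofLp),
    ⟨v - A.toLin (WithLp.toLp 2 (A.1ᴴ *ᵥ v.ofLp)), by
      rw [mem_perp_colSpan_iff, WithLp.ofLp_sub, Matrix.mulVec_sub, A.conjTranspose_mulVec_toLin,
        sub_self]⟩)
  map_add' p q := by
    simp only [WithLp.add_fst, WithLp.add_snd, map_add, Submodule.coe_add]
    abel
  map_smul' t p := by
    simp [A.toLin_real_smul]
  left_inv p := by
    have h := (mem_perp_colSpan_iff A _).1 p.snd.2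
    have h' : A.1ᴴ *ᵥ (A.toLin p.fst + (p.snd : EuclideanSpace 𝔽 (Fin n))).ofLp = p.fst.ofLp := by
      rw [WithLp.ofLp_add, Matrix.mulVec_add, h, add_zero, A.conjTranspose_mulVec_toLin]
    apply WithLp.ofLp_injective 2
    refine Prod.ext ?_ (Subtype.ext ?_)
    · exact WithLp.ofLp_injective 2 h'
    · simp only [h']
      exact add_sub_cancel_left _ _
  right_inv v := by simp
  norm_map' p := by
    have h := norm_toLin_add_sq A p.fst p.snd p.snd.2
    rw [← sq_eq_sq₀ (norm_nonneg _) (norm_nonneg _), WithLp.prod_norm_sq_eq_of_L2]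
    exact h

/-- Composition of matrices with orthonormal columns. -/
def Stiefel.comp {M N n : ℕ} (A : Stiefel 𝔽 N n) (B : Stiefel 𝔽 M N) : Stiefel 𝔽 M n :=
  ⟨A.1 * B.1, by
    rw [Matrix.conjTranspose_mul, Matrix.mul_assoc, ← Matrix.mul_assoc A.1ᴴ, A.2, Matrix.one_mul,
      B.2]⟩

theorem Stiefel.toLin_comp {M N n : ℕ} (A : Stiefel 𝔽 N n) (B : Stiefel 𝔽 M N)
    (w : EuclideanSpace 𝔽 (Fin M)) : (A.comp B).toLin w = A.toLin (B.toLin w) := by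
  apply WithLp.ofLp_injective 2
  rw [A.ofLp_toLin, B.ofLp_toLin, Matrix.mulVec_mulVec]
  rfl

theorem frame_mul {N n : ℕ} (h : N ≤ n) (U V : UnitaryGroup 𝔽 n) :
    frame h (U * V) = (frame le_rfl U).comp (frame h V) := by
  apply Subtype.ext
  ext i j
  simp [frame, Stiefel.comp, Matrix.mul_apply]

theorem toLin_frame_mul {N n : ℕ} (h : N ≤ n) (U V : UnitaryGroup 𝔽 n)
    (w : EuclideanSpace 𝔽 (Fin N)) :
    (frame h (U * V)).toLin w = (frame le_rfl U).toLin ((frame h V).toLin w) := by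
  rw [frame_mul, Stiefel.toLin_comp]

theorem frame_le_rfl_one_toLin {n : ℕ} (w : EuclideanSpace 𝔽 (Fin n)) :
    (frame le_rfl (1 : UnitaryGroup 𝔽 n)).toLin w = w := by
  apply WithLp.ofLp_injective 2
  rw [Stiefel.ofLp_toLin]
  simp [frame]

/-- Matrices with orthonormal columns extend to unitary matrices. -/
theorem frame_surjective [NormedStar 𝔽] {N n : ℕ} (h : N ≤ n) :
    Function.Surjective (frame h : UnitaryGroup 𝔽 n → Stiefel 𝔽 N n) := by
  intro A
  have hfd : FiniteDimensional 𝔽ᵐᵒᵖ (EuclideanSpace 𝔽 (Fin n)) :=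
    Module.Finite.equiv (coordEquiv 𝔽 n)
  -- The kernel of `Aᴴ` is the orthogonal complement of the columns of `A`. It has dimension `n -
  -- N`, and an orthonormal basis `C` of it completes `A`.
  let T : EuclideanSpace 𝔽 (Fin n) →ₗ[𝔽ᵐᵒᵖ] EuclideanSpace 𝔽 (Fin N) :=
    { toFun := fun v => WithLp.toLp 2 (A.1ᴴ *ᵥ v.ofLp)
      map_add' := fun v w => by ext i; simp [Matrix.mulVec_add]
      map_smul' := fun c w => by
        ext i
        simp [Matrix.mulVec, dotProduct, Finset.sum_mul, mul_assoc] }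
  have hT : Function.Surjective T := fun w => ⟨A.toLin w,
    WithLp.ofLp_injective 2 (A.conjTranspose_mulVec_toLin w)⟩
  have hker : Module.finrank 𝔽ᵐᵒᵖ (LinearMap.ker T) = n - N := by
    have := T.finrank_range_add_finrank_ker
    rw [LinearMap.range_eq_top.2 hT, finrank_top, finrank_euclideanSpace_op,
      finrank_euclideanSpace_op] at this
    omega
  obtain ⟨C, hC⟩ := colSpan_surjective (𝔽 := 𝔽) ⟨LinearMap.ker T, hker⟩
  have hC' : LinearMap.range C.toLin = LinearMap.ker T := congrArg Subtype.val hC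
  have hAC : A.1ᴴ * C.1 = 0 := by
    ext i j
    have h1 : C.toLin (WithLp.toLp 2 (Pi.single j 1)) ∈ LinearMap.ker T :=
      hC' ▸ LinearMap.mem_range_self _ _
    have h2 := congrFun (congrArg WithLp.ofLp (LinearMap.mem_ker.1 h1)) i
    have h3 : (A.1ᴴ *ᵥ C.1.col j) i = 0 := by simpa [T, Stiefel.ofLp_toLin] using h2
    exact h3
  have hCA : C.1ᴴ * A.1 = 0 := by
    have := congrArg conjTranspose hAC
    simpa using this
  let e : Fin N ⊕ Fin (n - N) ≃ Fin n := finSumFinEquiv.trans (finCongr (by omega))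
  let V : Matrix (Fin n) (Fin n) 𝔽 := (Matrix.fromCols A.1 C.1).submatrix id e.symm
  have hV : Vᴴ * V = 1 := by
    have h1 : (Matrix.fromCols A.1 C.1)ᴴ * Matrix.fromCols A.1 C.1 = 1 := by
      rw [Matrix.conjTranspose_fromCols_eq_fromRows_conjTranspose, Matrix.fromRows_mul_fromCols,
        A.2, C.2, hAC, hCA, Matrix.fromBlocks_one]
    have h2 : Vᴴ * V = ((Matrix.fromCols A.1 C.1)ᴴ * Matrix.fromCols A.1 C.1).submatrix
        e.symm e.symm := by
      ext i j
      rfl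
    rw [h2, h1, Matrix.submatrix_one_equiv]
  -- For square matrices over a division ring a one-sided inverse is two-sided, even without
  -- commutativity.
  have hV' : V * Vᴴ = 1 := mul_eq_one_symm hV
  refine ⟨⟨V, Unitary.mem_iff.2 ⟨hV, hV'⟩⟩, Subtype.ext ?_⟩
  ext i j
  have : e.symm (Fin.castLE h j) = Sum.inl j := by
    rw [Equiv.symm_apply_eq]
    apply Fin.ext
    simp [e]
  simp [frame, V, this]

/-- `Stiefel 𝔽 n n` is the unitary group. -/
theorem exists_frame_eq [NormedStar 𝔽] {n : ℕ} (A : Stiefel 𝔽 n n) :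
    ∃ U : UnitaryGroup 𝔽 n, frame le_rfl U = A := frame_surjective le_rfl A

/-- Two orthonormal bases of a subspace differ by a unitary matrix. -/
theorem exists_comp_eq_of_colSpan_eq {N n : ℕ} {A B : Stiefel 𝔽 N n}
    (h : colSpan A = colSpan B) : ∃ V : Stiefel 𝔽 N N, A.comp V = B := by
  -- `A Aᴴ` is the orthogonal projection onto the common column space, so it fixes the columns of
  -- `B`; this makes `Aᴴ B` the change of basis.
  have hBA : A.1 * (A.1ᴴ * B.1) = B.1 := by
    have key : ∀ w, A.toLin (WithLp.toLp 2 (A.1ᴴ *ᵥ (B.toLin w).ofLp)) = B.toLin w := by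
      intro w
      have hmem : B.toLin w ∈ LinearMap.range A.toLin := by
        have : LinearMap.range A.toLin = LinearMap.range B.toLin := congrArg Subtype.val h
        exact this ▸ LinearMap.mem_range_self _ _
      obtain ⟨v, hv⟩ := hmem
      rw [← hv, A.conjTranspose_mulVec_toLin]
    ext i j
    have := congrFun (congrArg WithLp.ofLp (key (WithLp.toLp 2 (Pi.single j 1)))) i
    rw [← Matrix.mul_assoc]
    have h1 : ((A.1 * A.1ᴴ) *ᵥ B.1.col j) i = B.1 i j := by
      simpa [Stiefel.ofLp_toLin, Matrix.mulVec_mulVec] using this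
    exact h1
  refine ⟨⟨A.1ᴴ * B.1, ?_⟩, Subtype.ext hBA⟩
  rw [Matrix.conjTranspose_mul, Matrix.conjTranspose_conjTranspose, Matrix.mul_assoc, hBA, B.2]

end Geometry

/-! ### Polar coordinates and radial integrals in different dimensions. -/

section Radial

theorem sphereArea_pos {l : ℕ} (hl : 0 < l) : 0 < sphereArea l := by
  have : (0 : ℝ) < (l : ℝ) / 2 := by positivity
  have := Real.Gamma_pos_of_pos this
  unfold sphereArea
  positivity

/-- The sphere has `dim` times the volume of the unit ball, and `Γ(x + 1) = x Γ(x)` at `x = dim / 2`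
absorbs the dimension. -/
theorem toSphere_univ_eq_sphereArea {E : Type*} [NormedAddCommGroup E] [InnerProductSpace ℝ E]
    [FiniteDimensional ℝ E] [MeasurableSpace E] [BorelSpace E] [Nontrivial E] :
    (volume : Measure E).toSphere Set.univ =
      ENNReal.ofReal (sphereArea (Module.finrank ℝ E)) := by
  have hd : (0 : ℝ) < Module.finrank ℝ E := by exact_mod_cast Module.finrank_pos
  rw [Measure.toSphere_apply_univ, InnerProductSpace.volume_ball, ENNReal.ofReal_one, one_pow,
    one_mul, ← ENNReal.ofReal_natCast, ← ENNReal.ofReal_mul hd.le]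
  congr 1
  have hG := Real.Gamma_pos_of_pos (half_pos hd)
  rw [Real.Gamma_add_one (half_pos hd).ne', sphereArea, Real.sqrt_eq_rpow, ← Real.rpow_natCast,
    ← Real.rpow_mul Real.pi_pos.le, one_div_mul_eq_div]
  field_simp

/-- Polar coordinates for radial functions. -/
theorem lintegral_fun_norm {E : Type*} [NormedAddCommGroup E] [InnerProductSpace ℝ E]
    [FiniteDimensional ℝ E] [MeasurableSpace E] [BorelSpace E] [Nontrivial E]
    {φ : ℝ → ℝ≥0∞} (hφ : Measurable φ) :
    ∫⁻ x : E, φ ‖x‖ = ENNReal.ofReal (sphereArea (Module.finrank ℝ E)) *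
      ∫⁻ y in Set.Ioi (0 : ℝ), ENNReal.ofReal (y ^ (Module.finrank ℝ E - 1)) * φ y := by
  calc ∫⁻ x : E, φ ‖x‖ = ∫⁻ x : ({(0 : E)}ᶜ : Set E), φ ‖x.1‖
          ∂((volume : Measure E).comap Subtype.val) := by
        rw [lintegral_subtype_comap (measurableSet_singleton _).compl fun x : E ↦ φ ‖x‖,
          restrict_compl_singleton]
    _ = ∫⁻ x, φ x.2 ∂(volume : Measure E).toSphere.prod
          (.volumeIoiPow (Module.finrank ℝ E - 1)) := by
        simpa using ((volume : Measure E).measurePreserving_homeomorphUnitSphereProd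
          |>.lintegral_comp_emb (Homeomorph.measurableEmbedding _)
          (φ ∘ Subtype.val ∘ Prod.snd))
    _ = _ := by
        have hφ' : Measurable fun y : Set.Ioi (0 : ℝ) => φ y := hφ.comp measurable_subtype_coe
        rw [lintegral_prod (fun x : Metric.sphere (0 : E) 1 × Set.Ioi (0 : ℝ) => φ x.2)
          (hφ'.comp measurable_snd).aemeasurable]
        simp only [lintegral_const]
        rw [toSphere_univ_eq_sphereArea, mul_comm]
        congr 1
        rw [Measure.volumeIoiPow, lintegral_withDensity_eq_lintegral_mul _ (by fun_prop) hφ',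
          ← lintegral_subtype_comap measurableSet_Ioi]
        rfl

/-- Comparison of radial integrals in different dimensions. -/
theorem lintegral_fun_norm_eq {E₁ E₂ : Type*} [NormedAddCommGroup E₁] [InnerProductSpace ℝ E₁]
    [FiniteDimensional ℝ E₁] [MeasurableSpace E₁] [BorelSpace E₁]
    [NormedAddCommGroup E₂] [InnerProductSpace ℝ E₂]
    [FiniteDimensional ℝ E₂] [MeasurableSpace E₂] [BorelSpace E₂] {d e : ℕ} (hd : 0 < d)
    (h₁ : Module.finrank ℝ E₁ = d + e) (h₂ : Module.finrank ℝ E₂ = d)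
    {φ : ℝ → ℝ≥0∞} (hφ : Measurable φ) :
    ∫⁻ x : E₁, φ ‖x‖ = ENNReal.ofReal (sphereArea (d + e)) * (ENNReal.ofReal (sphereArea d))⁻¹ *
      ∫⁻ x : E₂, ENNReal.ofReal (‖x‖ ^ e) * φ ‖x‖ := by
  have : Nontrivial E₁ := Module.nontrivial_of_finrank_pos (R := ℝ) (by omega)
  have : Nontrivial E₂ := Module.nontrivial_of_finrank_pos (R := ℝ) (by omega)
  rw [lintegral_fun_norm hφ, lintegral_fun_norm (E := E₂)
    (φ := fun y => ENNReal.ofReal (y ^ e) * φ y) (by fun_prop), h₁, h₂]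
  have h0 : ENNReal.ofReal (sphereArea d) ≠ 0 := by simpa using sphereArea_pos hd
  rw [mul_assoc, ← mul_assoc _ (ENNReal.ofReal (sphereArea d)),
    ENNReal.inv_mul_cancel h0 ENNReal.ofReal_ne_top, one_mul]
  congr 1
  refine setLIntegral_congr_fun measurableSet_Ioi fun y (hy : 0 < y) => ?_
  rw [← mul_assoc, ← ENNReal.ofReal_mul (by positivity), ← pow_add]
  congr 3
  -- The exponents `(d - 1) + e` and `d + e - 1` agree in `ℕ` only because `d > 0`.
  omega

end Radial

/-! ### Normalisation of Haar measure on a compact group. -/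

section Haar

variable {G : Type*} [Group G] [TopologicalSpace G] [IsTopologicalGroup G] [CompactSpace G]
  [MeasurableSpace G] [BorelSpace G]

instance isProbabilityMeasure_haarMeasure_top :
    IsProbabilityMeasure (Measure.haarMeasure (⊤ : TopologicalSpace.PositiveCompacts G)) :=
  ⟨by simpa using Measure.haarMeasure_self (K₀ := (⊤ : TopologicalSpace.PositiveCompacts G))⟩

end Haar

/-! ### Measurability, Fubini along a subspace and invariance of measures. -/

section Measure

set_option linter.unusedSectionVars false

variable {𝔽 : Type} [NormedDivisionRing 𝔽] [StarRing 𝔽] [InnerProductSpace ℝ 𝔽]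
  [SMulCommClass ℝ 𝔽 𝔽] [IsScalarTower ℝ 𝔽 𝔽] [FiniteDimensional ℝ 𝔽] [ContinuousStar 𝔽]
  [NormedStar 𝔽] [SecondCountableTopology 𝔽] [MeasurableSpace 𝔽] [BorelSpace 𝔽]

instance (N n : ℕ) : SecondCountableTopology (Stiefel 𝔽 N n) :=
  inferInstanceAs (SecondCountableTopology
    {A : Fin n → Fin N → 𝔽 // (Matrix.of A)ᴴ * Matrix.of A = 1})

instance (n : ℕ) : SecondCountableTopology (UnitaryGroup 𝔽 n) :=
  inferInstanceAs (SecondCountableTopology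
    {A : Fin n → Fin n → 𝔽 // Matrix.of A ∈ unitary (Matrix (Fin n) (Fin n) 𝔽)})

theorem continuous_toLin {N n : ℕ} : Continuous fun p : Stiefel 𝔽 N n × EuclideanSpace 𝔽 (Fin N) =>
    p.1.toLin p.2 := by
  have h : Continuous fun A : Stiefel 𝔽 N n => A.1 := continuous_subtype_val
  exact (PiLp.continuous_toLp 2 _).comp ((h.comp continuous_fst).matrix_mulVec
    ((PiLp.continuous_ofLp 2 _).comp continuous_snd))

theorem continuous_frame {N n : ℕ} (h : N ≤ n) :
    Continuous (frame h : UnitaryGroup 𝔽 n → Stiefel 𝔽 N n) :=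
  Continuous.subtype_mk (continuous_subtype_val.matrix_submatrix _ _) _

theorem measurable_toLin {N n : ℕ} (A : Stiefel 𝔽 N n) : Measurable A.toLin :=
  (continuous_toLin.comp (Continuous.prodMk_right A)).measurable

theorem finrank_euclideanSpace_real (n : ℕ) :
    Module.finrank ℝ (EuclideanSpace 𝔽 (Fin n)) = Module.finrank ℝ 𝔽 * n := by
  rw [(WithLp.linearEquiv 2 ℝ (Fin n → 𝔽)).finrank_eq, Module.finrank_pi_fintype]
  simp [mul_comm]

theorem finrank_perp {N n : ℕ} (A : Stiefel 𝔽 N n) :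
    Module.finrank ℝ (perp (colSpan A)) = Module.finrank ℝ 𝔽 * (n - N) := by
  have h := A.decomp.toLinearEquiv.finrank_eq
  rw [(WithLp.linearEquiv 2 ℝ _).finrank_eq, Module.finrank_prod, finrank_euclideanSpace_real,
    finrank_euclideanSpace_real] at h
  rw [Nat.mul_sub]
  omega

theorem lintegral_eq_lintegral_perp {N n : ℕ} (A : Stiefel 𝔽 N n)
    {g : EuclideanSpace 𝔽 (Fin n) → ℝ≥0∞} (hg : Measurable g) :
    ∫⁻ v, g v = ∫⁻ r : perp (colSpan A), ∫⁻ w, g (A.toLin w + r) := by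
  have hmp := A.decomp.measurePreserving.comp
    (WithLp.volume_preserving_toLp (EuclideanSpace 𝔽 (Fin N)) (perp (colSpan A)))
  rw [← hmp.lintegral_comp hg, Measure.volume_eq_prod, lintegral_prod_symm]
  · rfl
  · exact (hg.comp hmp.measurable).aemeasurable

theorem measurePreserving_toLin {n : ℕ} (A : Stiefel 𝔽 n n) :
    MeasurePreserving A.toLin volume volume := by
  let F : EuclideanSpace 𝔽 (Fin n) →ₗᵢ[ℝ] EuclideanSpace 𝔽 (Fin n) :=
    { toFun := A.toLin
      map_add' := A.toLin.map_add
      map_smul' := A.toLin_real_smul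
      norm_map' := A.norm_toLin }
  exact (F.toLinearIsometryEquiv rfl).measurePreserving

theorem measurePreserving_toLin_pi {n : ℕ} (A : Stiefel 𝔽 n n) (k : ℕ) :
    MeasurePreserving (fun (x : Fin k → EuclideanSpace 𝔽 (Fin n)) i => A.toLin (x i))
      volume volume :=
  volume_preserving_pi fun _ => measurePreserving_toLin A

/-- A compact group is unimodular: a right translate of the Haar probability measure is again a
left-invariant probability measure, hence the same one. -/
instance (n : ℕ) : (Measure.haarMeasure
    (⊤ : TopologicalSpace.PositiveCompacts (UnitaryGroup 𝔽 n))).IsMulRightInvariant where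
  map_mul_right_eq_self g := by
    have : IsProbabilityMeasure ((Measure.haarMeasure
      (⊤ : TopologicalSpace.PositiveCompacts (UnitaryGroup 𝔽 n))).map (· * g)) :=
      Measure.isProbabilityMeasure_map (by fun_prop)
    exact Measure.isHaarMeasure_eq_of_isProbabilityMeasure _ _

end Measure

/-! ### Block triangular columns, abstract determinants and unitary invariance. -/

section Extension

set_option linter.unusedSectionVars false

variable {𝔽 : Type} [NormedDivisionRing 𝔽] [StarRing 𝔽] [InnerProductSpace ℝ 𝔽]
  [SMulCommClass ℝ 𝔽 𝔽] [IsScalarTower ℝ 𝔽 𝔽]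

/-- Append a coordinate to a vector. -/
def snocVec {N : ℕ} (a : EuclideanSpace 𝔽 (Fin N)) (c : 𝔽) : EuclideanSpace 𝔽 (Fin (N + 1)) :=
  WithLp.toLp 2 (Fin.snoc (α := fun _ => 𝔽) a.ofLp c)

/-- Append a unit vector to an orthonormal system. -/
def Stiefel.snoc [NormedStar 𝔽] {N n : ℕ} (A : Stiefel 𝔽 N n) (u : EuclideanSpace 𝔽 (Fin n))
    (hu : u ∈ perp (colSpan A)) (hn : ‖u‖ = 1) : Stiefel 𝔽 (N + 1) n :=
  ⟨Matrix.of fun i => Fin.snoc (α := fun _ => 𝔽) (A.1 i) (u i), by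
    have h1 : ∀ j, ∑ i, star (A.1 i j) * u i = 0 := fun j => by
      simpa [Matrix.mulVec, dotProduct] using congrFun ((mem_perp_colSpan_iff A u).1 hu) j
    have h2 : ∀ j, ∑ i, star (u i) * A.1 i j = 0 := fun j => by
      have := congrArg star (h1 j)
      simpa [star_sum] using this
    have h3 : ∑ i, star (u i) * u i = 1 := by
      simpa [dotProduct, hn] using star_dotProduct_self u
    ext a b
    rw [Matrix.mul_apply]
    refine Fin.lastCases ?_ (fun a => ?_) a <;> refine Fin.lastCases ?_ (fun b => ?_) b
    · simpa using h3
    · simpa [(Fin.castSucc_lt_last b).ne'] using h2 b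
    · simpa [(Fin.castSucc_lt_last a).ne] using h1 a
    · have := congrFun (congrFun A.2 a) b
      rw [Matrix.mul_apply] at this
      simpa [Matrix.one_apply] using this⟩

theorem Stiefel.snoc_toLin [NormedStar 𝔽] {N n : ℕ} (A : Stiefel 𝔽 N n)
    (u : EuclideanSpace 𝔽 (Fin n)) (hu : u ∈ perp (colSpan A)) (hn : ‖u‖ = 1)
    (a : EuclideanSpace 𝔽 (Fin N)) (t : ℝ) :
    (A.snoc u hu hn).toLin (snocVec a (t • 1)) = A.toLin a + t • u := by
  ext i
  simp [Stiefel.toLin, Matrix.mulVec, dotProduct, Fin.sum_univ_castSucc, Stiefel.snoc, snocVec]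

theorem frame_one_snocVec_zero {N n : ℕ} (h : N + 1 ≤ n) (a : EuclideanSpace 𝔽 (Fin N)) :
    (frame h (1 : UnitaryGroup 𝔽 n)).toLin (snocVec a 0) =
      (frame (Nat.le_of_succ_le h) 1).toLin a := by
  ext i
  simp [Stiefel.toLin, Matrix.mulVec, dotProduct, Fin.sum_univ_castSucc, snocVec, frame]
  rfl

/-- A vector orthogonal to the first `N` coordinates can be rotated into the next axis. -/
theorem exists_stiefel_snocVec [NormedStar 𝔽] {N n : ℕ} (h : N + 1 ≤ n)
    (b : perp (colSpan (frame (Nat.le_of_succ_le h) (1 : UnitaryGroup 𝔽 n)))) :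
    ∃ A : Stiefel 𝔽 (N + 1) n,
      (∀ a, A.toLin (snocVec a 0) = (frame (Nat.le_of_succ_le h) 1).toLin a) ∧
      ∀ a, A.toLin (snocVec a (‖b‖ • 1)) = (frame (Nat.le_of_succ_le h) 1).toLin a + b := by
  -- The new column is `b / ‖b‖`. When `b = 0` there is no direction to follow and the standard
  -- frame serves.
  by_cases hb : b = 0
  · refine ⟨frame h 1, frame_one_snocVec_zero h, fun a => ?_⟩
    simp [hb, frame_one_snocVec_zero h]
  · have hb' : ‖b‖ ≠ 0 := norm_ne_zero_iff.2 hb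
    have hn : ‖((‖b‖⁻¹ • b : perp _) : EuclideanSpace 𝔽 (Fin n))‖ = 1 := by
      change ‖‖b‖⁻¹ • b‖ = 1
      rw [norm_smul, norm_inv, norm_norm, inv_mul_cancel₀ hb']
    refine ⟨Stiefel.snoc _ _ (‖b‖⁻¹ • b).2 hn, fun a => ?_, fun a => ?_⟩
    · have := Stiefel.snoc_toLin _ _ (‖b‖⁻¹ • b).2 hn a 0
      simpa using this
    · rw [Stiefel.snoc_toLin, Submodule.coe_smul, smul_smul, mul_inv_cancel₀ hb', one_smul]

/-- The matrix with the given columns. -/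
def colMatrix {N : ℕ} (y : Fin N → EuclideanSpace 𝔽 (Fin N)) : Matrix (Fin N) (Fin N) 𝔽 :=
  Matrix.of fun i k => y k i

theorem colMatrix_toLin {N : ℕ} (A : Stiefel 𝔽 N N) (y : Fin N → EuclideanSpace 𝔽 (Fin N)) :
    colMatrix (fun k => A.toLin (y k)) = A.1 * colMatrix y := by
  ext i k
  simp [colMatrix, Stiefel.toLin, Matrix.mul_apply, Matrix.mulVec, dotProduct]

/-- The columns of the block triangular matrix `[T, a; 0, t]`. -/
def blockColumns {N : ℕ} (T : Fin N → EuclideanSpace 𝔽 (Fin N)) (a : EuclideanSpace 𝔽 (Fin N))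
    (t : ℝ) : Fin (N + 1) → EuclideanSpace 𝔽 (Fin (N + 1)) :=
  Fin.snoc (α := fun _ => EuclideanSpace 𝔽 (Fin (N + 1))) (fun k => snocVec (T k) 0)
    (snocVec a (t • 1))

theorem toLin_comp_blockColumns {N n : ℕ} (A : Stiefel 𝔽 (N + 1) n)
    (T : Fin N → EuclideanSpace 𝔽 (Fin N)) (a : EuclideanSpace 𝔽 (Fin N)) (t : ℝ) :
    (fun k => A.toLin (blockColumns T a t k)) =
      Fin.snoc (α := fun _ => EuclideanSpace 𝔽 (Fin n)) (fun k => A.toLin (snocVec (T k) 0))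
        (A.toLin (snocVec a (t • 1))) := by
  ext1 k
  refine Fin.lastCases ?_ (fun k => ?_) k <;> simp [blockColumns]

/-- A modulus of the determinant on square matrices over `𝔽`. -/
structure IsAbsDet (D : ∀ N, Matrix (Fin N) (Fin N) 𝔽 → ℝ) : Prop where
  nonneg : ∀ N M, 0 ≤ D N M
  continuous : ∀ N, Continuous (D N)
  zero_dim : ∀ M, D 0 M = 1
  unitary_mul : ∀ N (U M : Matrix (Fin N) (Fin N) 𝔽), Uᴴ * U = 1 → D N (U * M) = D N M
  block : ∀ N (M : Matrix (Fin (N + 1)) (Fin (N + 1)) 𝔽) (t : ℝ), 0 ≤ t →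
    (∀ j : Fin N, M (Fin.last N) j.castSucc = 0) → M (Fin.last N) (Fin.last N) = t • 1 →
    D (N + 1) M = D N (M.submatrix Fin.castSucc Fin.castSucc) * t

theorem IsAbsDet.colMatrix_toLin {D : ∀ N, Matrix (Fin N) (Fin N) 𝔽 → ℝ} (hD : IsAbsDet D)
    {N : ℕ} (A : Stiefel 𝔽 N N) (y : Fin N → EuclideanSpace 𝔽 (Fin N)) :
    D N (colMatrix fun k => A.toLin (y k)) = D N (colMatrix y) := by
  rw [BlaschkePetkantschin.colMatrix_toLin, hD.unitary_mul _ _ _ A.2]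

/-- The corner entry will be a length `‖b‖`, so the block rule is needed only for a nonnegative real
corner, and full multiplicativity of `D` over `ℍ` is never used. -/
theorem IsAbsDet.colMatrix_blockColumns {D : ∀ N, Matrix (Fin N) (Fin N) 𝔽 → ℝ} (hD : IsAbsDet D)
    {N : ℕ} (T : Fin N → EuclideanSpace 𝔽 (Fin N)) (a : EuclideanSpace 𝔽 (Fin N)) {t : ℝ}
    (ht : 0 ≤ t) : D (N + 1) (colMatrix (blockColumns T a t)) = D N (colMatrix T) * t := by
  rw [hD.block N _ t ht]
  · congr 2
    ext i j
    simp [colMatrix, blockColumns, snocVec]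
  · intro j
    simp [colMatrix, blockColumns, snocVec]
  · simp [colMatrix, blockColumns, snocVec]

/-- Invariance of a function of `k` vectors under the unitary group. -/
def IsUnitaryInvariant {n k : ℕ} (g : (Fin k → EuclideanSpace 𝔽 (Fin n)) → ℝ≥0∞) : Prop :=
  ∀ (U : Stiefel 𝔽 n n) x, g (fun i => U.toLin (x i)) = g x

/-- The unitary group acts transitively on orthonormal frames, so an invariant function cannot tell
which frame embeds `𝔽^M` in `𝔽^n`. -/
theorem IsUnitaryInvariant.stiefel_eq [NormedStar 𝔽] {M n k : ℕ} (h : M ≤ n)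
    {g : (Fin k → EuclideanSpace 𝔽 (Fin n)) → ℝ≥0∞} (hg : IsUnitaryInvariant g)
    (A : Stiefel 𝔽 M n) (y : Fin k → EuclideanSpace 𝔽 (Fin M)) :
    g (fun i => A.toLin (y i)) = g (fun i => (frame h 1).toLin (y i)) := by
  obtain ⟨U, rfl⟩ := frame_surjective h A
  rw [← hg (frame le_rfl U) fun i => (frame h 1).toLin (y i)]
  congr 1
  ext1 i
  rw [← toLin_frame_mul, mul_one]

end Extension

/-! ### Induction on the number of vectors for invariant functions. -/

section Induction

set_option linter.unusedSectionVars false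

variable {𝔽 : Type} [NormedDivisionRing 𝔽] [StarRing 𝔽] [InnerProductSpace ℝ 𝔽]
  [SMulCommClass ℝ 𝔽 𝔽] [IsScalarTower ℝ 𝔽 𝔽] [FiniteDimensional ℝ 𝔽] [ContinuousStar 𝔽]
  [NormedStar 𝔽] [SecondCountableTopology 𝔽] [MeasurableSpace 𝔽] [BorelSpace 𝔽]

theorem continuous_snocVec {N : ℕ} :
    Continuous fun p : EuclideanSpace 𝔽 (Fin N) × 𝔽 => snocVec p.1 p.2 :=
  (PiLp.continuous_toLp 2 _).comp
    (Continuous.finSnoc (A := fun _ => 𝔽)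
      ((PiLp.continuous_ofLp 2 _).comp continuous_fst) continuous_snd)

theorem continuous_blockColumns {N : ℕ} :
    Continuous fun p : ((Fin N → EuclideanSpace 𝔽 (Fin N)) × EuclideanSpace 𝔽 (Fin N)) × ℝ =>
      blockColumns p.1.1 p.1.2 p.2 := by
  refine Continuous.finSnoc (A := fun _ => EuclideanSpace 𝔽 (Fin (N + 1)))
    (continuous_pi fun k => ?_) ?_
  · have h : Continuous fun p : ((Fin N → EuclideanSpace 𝔽 (Fin N)) ×
        EuclideanSpace 𝔽 (Fin N)) × ℝ => (p.1.1 k, (0 : 𝔽)) := by fun_prop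
    exact continuous_snocVec.comp h
  · exact continuous_snocVec.comp ((continuous_snd.comp continuous_fst).prodMk
      (continuous_snd.smul continuous_const))

theorem measurable_toLin_pi {N n k : ℕ} (A : Stiefel 𝔽 N n) :
    Measurable fun (y : Fin k → EuclideanSpace 𝔽 (Fin N)) i => A.toLin (y i) :=
  measurable_pi_lambda _ fun i => (measurable_toLin A).comp (measurable_pi_apply i)

theorem IsAbsDet.measurable {D : ∀ N, Matrix (Fin N) (Fin N) 𝔽 → ℝ} (hD : IsAbsDet D) (N p : ℕ) :
    Measurable fun T : Fin N → EuclideanSpace 𝔽 (Fin N) =>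
      ENNReal.ofReal (D N (colMatrix T) ^ p) := by
  have h : Continuous fun T : Fin N → EuclideanSpace 𝔽 (Fin N) => colMatrix T :=
    continuous_pi fun i => continuous_pi fun k =>
      (continuous_apply i).comp ((PiLp.continuous_ofLp 2 _).comp (continuous_apply k))
  exact (ENNReal.continuous_ofReal.comp (((hD.continuous N).comp h).pow p)).measurable

theorem lintegral_snoc {E : Type} [MeasureSpace E] [SigmaFinite (volume : Measure E)] {N : ℕ}
    {g : (Fin (N + 1) → E) → ℝ≥0∞} (hg : Measurable g) :
    ∫⁻ x, g x = ∫⁻ X : Fin N → E, ∫⁻ t, g (Fin.snoc (α := fun _ => E) X t) := by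
  have hmp := (volume_preserving_piFinSuccAbove (fun _ : Fin (N + 1) => E) (Fin.last N)).symm
  rw [← hmp.lintegral_comp hg, Measure.volume_eq_prod, lintegral_prod_symm]
  · refine lintegral_congr fun X => lintegral_congr fun t => ?_
    congr 1
    simp [MeasurableEquiv.piFinSuccAbove, Fin.insertNthEquiv, Fin.insertNth_last']
  · exact (hg.comp hmp.measurable).aemeasurable

theorem measurable_snoc {E : Type} [MeasurableSpace E] {N : ℕ} :
    Measurable fun p : (Fin N → E) × E => Fin.snoc (α := fun _ => E) p.1 p.2 := by
  refine measurable_pi_lambda _ fun i => ?_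
  refine Fin.lastCases ?_ (fun i => ?_) i
  · simpa using measurable_snd
  · simpa [Function.comp_def] using (measurable_pi_apply i).comp measurable_fst

/-- Adding one more vector in general position to an orthonormal reduction of `N` vectors. -/
theorem lintegral_blockColumns {D : ∀ N, Matrix (Fin N) (Fin N) 𝔽 → ℝ}
    {N n : ℕ} (h : N + 1 ≤ n) {c : ℝ≥0∞} {p : ℕ}
    (IH : ∀ g : (Fin N → EuclideanSpace 𝔽 (Fin n)) → ℝ≥0∞, Measurable g → IsUnitaryInvariant g →
      ∫⁻ x, g x = c * ∫⁻ T : Fin N → EuclideanSpace 𝔽 (Fin N),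
        ENNReal.ofReal (D N (colMatrix T) ^ p) *
          g (fun k => (frame (Nat.le_of_succ_le h) 1).toLin (T k)))
    {g : (Fin (N + 1) → EuclideanSpace 𝔽 (Fin n)) → ℝ≥0∞} (hg : Measurable g)
    (hinv : IsUnitaryInvariant g) :
    ∫⁻ x, g x = c * ∫⁻ T : Fin N → EuclideanSpace 𝔽 (Fin N),
      ENNReal.ofReal (D N (colMatrix T) ^ p) *
        ∫⁻ b : perp (colSpan (frame (Nat.le_of_succ_le h) (1 : UnitaryGroup 𝔽 n))),
          ∫⁻ a, g (fun k => (frame h 1).toLin (blockColumns T a ‖b‖ k)) := by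
  have hgm : Measurable fun q : (Fin N → EuclideanSpace 𝔽 (Fin n)) × EuclideanSpace 𝔽 (Fin n) =>
      g (Fin.snoc (α := fun _ => EuclideanSpace 𝔽 (Fin n)) q.1 q.2) := hg.comp measurable_snoc
  -- The hypothesis is applied to the integral of `g` over its last vector. This is an invariant
  -- function of the first `N` vectors, because rotating the last one preserves Lebesgue measure.
  rw [lintegral_snoc hg, IH _ hgm.lintegral_prod_right']
  · congr 1
    refine lintegral_congr fun T => ?_
    congr 1
    refine (lintegral_eq_lintegral_perp (frame (Nat.le_of_succ_le h) 1)
      (hgm.comp measurable_prodMk_left)).trans ?_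
    refine lintegral_congr fun b => lintegral_congr fun a => ?_
    -- `A` agrees with the standard embedding on `𝔽^N` and sends the next axis, scaled by `‖b‖`, to
    -- `b`. By invariance it may be replaced by the standard frame, leaving only `‖b‖`.
    obtain ⟨A, hA0, hA⟩ := exists_stiefel_snocVec h b
    rw [← hinv.stiefel_eq h A, toLin_comp_blockColumns]
    simp only [hA0, hA, Function.comp_apply]
  · intro U x
    refine ((measurePreserving_toLin U).lintegral_comp
      (hgm.comp measurable_prodMk_left)).symm.trans (lintegral_congr fun t => ?_)
    refine Eq.trans ?_ (hinv U (Fin.snoc (α := fun _ => EuclideanSpace 𝔽 (Fin n)) x t))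
    change g _ = g _
    congr 1
    ext1 i
    refine Fin.lastCases ?_ (fun i => ?_) i <;> simp

theorem stiefelVolume_succ {N n : ℕ} (h : N + 1 ≤ n) :
    stiefelVolume 𝔽 (N + 1) n =
      stiefelVolume 𝔽 N n * ENNReal.ofReal (sphereArea (Module.finrank ℝ 𝔽 * (n - N))) := by
  have hβ : 0 < Module.finrank ℝ 𝔽 := Module.finrank_pos
  rw [stiefelVolume, stiefelVolume, Finset.prod_Icc_succ_top (by omega), ENNReal.ofReal_mul']
  · congr 4
    omega
  · exact (sphereArea_pos (by positivity)).le

theorem stiefelVolume_ne_zero {N n : ℕ} : stiefelVolume 𝔽 N n ≠ 0 := by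
  have hβ : 0 < Module.finrank ℝ 𝔽 := Module.finrank_pos
  rw [stiefelVolume, Ne, ENNReal.ofReal_eq_zero, not_le]
  exact Finset.prod_pos fun i _ => sphereArea_pos (by positivity)

theorem stiefelVolume_ne_top {N n : ℕ} : stiefelVolume 𝔽 N n ≠ ∞ := ENNReal.ofReal_ne_top

/-- The linear Blaschke-Petkantschin formula for unitarily invariant functions. -/
theorem lintegral_of_isUnitaryInvariant {D : ∀ N, Matrix (Fin N) (Fin N) 𝔽 → ℝ} (hD : IsAbsDet D)
    (N : ℕ) : ∀ {n : ℕ} (h : N ≤ n) (g : (Fin N → EuclideanSpace 𝔽 (Fin n)) → ℝ≥0∞),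
    Measurable g → IsUnitaryInvariant g →
      ∫⁻ x, g x = (stiefelVolume 𝔽 N N)⁻¹ * stiefelVolume 𝔽 N n *
        ∫⁻ T : Fin N → EuclideanSpace 𝔽 (Fin N),
          ENNReal.ofReal (D N (colMatrix T) ^ (Module.finrank ℝ 𝔽 * (n - N))) *
            g (fun k => (frame h 1).toLin (T k)) := by
  have hβ : 0 < Module.finrank ℝ 𝔽 := Module.finrank_pos
  induction N with
  | zero =>
    -- With no vectors both integrals are evaluations at the unique point, and both volumes are
    -- empty products.
    intro n h g _ _
    rw [volume_pi, Measure.pi_of_empty _ default, lintegral_dirac, volume_pi,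
      Measure.pi_of_empty _ default, lintegral_dirac]
    simp only [stiefelVolume, hD.zero_dim]
    simp only [zero_lt_one, Finset.Icc_eq_empty_of_lt, Finset.prod_empty, ENNReal.ofReal_one,
      one_pow, inv_one, one_mul]
    congr 1
    exact Subsingleton.elim _ _
  | succ N ih =>
    intro n h g hg hinv
    obtain ⟨m, rfl⟩ : ∃ m, n = N + 1 + m := ⟨n - (N + 1), by omega⟩
    have hN : N ≤ N + 1 + m := by omega
    set β := Module.finrank ℝ 𝔽
    have e1 : N + 1 + m - N = 1 + m := by omega
    have e2 : N + 1 + m - (N + 1) = m := by omega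
    have e3 : N + 1 - N = 1 := by omega
    -- The integrand left for `b` once `a` is integrated out, as a function of the length `t = ‖b‖`.
    set φ : (Fin N → EuclideanSpace 𝔽 (Fin N)) → ℝ → ℝ≥0∞ := fun T t =>
      ∫⁻ a, g (fun k => (frame h 1).toLin (blockColumns T a t k)) with hφ
    have hφm : ∀ T, Measurable (φ T) := fun T => by
      have h1 : Measurable fun q : ℝ × EuclideanSpace 𝔽 (Fin N) =>
          g (fun k => (frame h 1).toLin (blockColumns T q.2 q.1 k)) :=
        hg.comp ((measurable_toLin_pi _).comp (continuous_blockColumns.comp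
          ((continuous_const.prodMk continuous_snd).prodMk continuous_fst)).measurable)
      exact h1.lintegral_prod_right'
    have hL := lintegral_blockColumns (D := D) h (fun g hg hi => ih hN g hg hi) hg hinv
    -- The right-hand integrand of the goal is itself invariant, so the induction hypothesis also
    -- reduces it, now with ambient dimension `N + 1`.
    set g' : (Fin (N + 1) → EuclideanSpace 𝔽 (Fin (N + 1))) → ℝ≥0∞ := fun T =>
      ENNReal.ofReal (D (N + 1) (colMatrix T) ^ (β * m)) *
        g (fun k => (frame h 1).toLin (T k)) with hg'
    have hgm' : Measurable g' := (hD.measurable _ _).mul (hg.comp (measurable_toLin_pi _))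
    have hinv' : IsUnitaryInvariant g' := fun U x => by
      simp only [hg', hD.colMatrix_toLin]
      congr 1
      simp only [← Stiefel.toLin_comp]
      exact hinv.stiefel_eq h _ _
    have hR := lintegral_blockColumns (D := D) le_rfl
      (fun g hg hi => ih (Nat.le_succ N) g hg hi) hgm' hinv'
    -- For fixed `T` the two reductions differ only in the dimension of `b`: `β + β m` against `β`.
    -- The excess `‖b‖^{β m}` combines with `D(T)^{β m}` into the weight of `g'`, leaving `D(T)^β`.
    have key : ∀ T : Fin N → EuclideanSpace 𝔽 (Fin N),
        ENNReal.ofReal (D N (colMatrix T) ^ (β * (1 + m))) *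
          ∫⁻ b : perp (colSpan (frame hN (1 : UnitaryGroup 𝔽 (N + 1 + m)))), φ T ‖b‖ =
        ENNReal.ofReal (sphereArea (β + β * m)) * (ENNReal.ofReal (sphereArea β))⁻¹ *
          (ENNReal.ofReal (D N (colMatrix T) ^ β) *
          ∫⁻ b : perp (colSpan (frame (Nat.le_succ N) (1 : UnitaryGroup 𝔽 (N + 1)))),
            ∫⁻ a, g' (fun k => (frame le_rfl 1).toLin (blockColumns T a ‖b‖ k))) := by
      intro T
      rw [lintegral_fun_norm_eq (E₂ := perp (colSpan (frame (Nat.le_succ N)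
        (1 : UnitaryGroup 𝔽 (N + 1))))) (d := β) (e := β * m) hβ
        (by rw [finrank_perp, e1, mul_add, mul_one]) (by rw [finrank_perp, e3, mul_one]) (hφm T),
        mul_left_comm]
      congr 1
      have : ∀ (b : perp (colSpan (frame (Nat.le_succ N) (1 : UnitaryGroup 𝔽 (N + 1))))),
          ∫⁻ a, g' (fun k => (frame le_rfl 1).toLin (blockColumns T a ‖b‖ k)) =
          ENNReal.ofReal (D N (colMatrix T) ^ (β * m)) *
            (ENNReal.ofReal (‖b‖ ^ (β * m)) * φ T ‖b‖) := by
        intro b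
        simp only [frame_le_rfl_one_toLin, hg', hφ]
        have hm : Measurable fun a =>
            g (fun k => (frame h 1).toLin (blockColumns T a ‖b‖ k)) :=
          hg.comp ((measurable_toLin_pi _).comp (continuous_blockColumns.comp
            ((continuous_const.prodMk continuous_id).prodMk continuous_const)).measurable)
        rw [← mul_assoc, ← ENNReal.ofReal_mul (pow_nonneg (hD.nonneg _ _) _), ← mul_pow,
          ← lintegral_const_mul _ hm]
        refine lintegral_congr fun a => ?_
        rw [hD.colMatrix_blockColumns _ _ (norm_nonneg _)]
      simp only [this]
      rw [lintegral_const_mul' _ _ ENNReal.ofReal_ne_top, ← mul_assoc,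
        ← ENNReal.ofReal_mul (pow_nonneg (hD.nonneg _ _) _), ← pow_add, mul_add, mul_one]
    have hmeas : Measurable fun T : Fin N → EuclideanSpace 𝔽 (Fin N) =>
        (ENNReal.ofReal (D N (colMatrix T) ^ β) *
          ∫⁻ b : perp (colSpan (frame (Nat.le_succ N) (1 : UnitaryGroup 𝔽 (N + 1)))),
            ∫⁻ a, g' (fun k => (frame le_rfl 1).toLin (blockColumns T a ‖b‖ k))) := by
      refine (hD.measurable _ _).mul ?_
      have h1 : Measurable fun q : ((Fin N → EuclideanSpace 𝔽 (Fin N)) ×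
          perp (colSpan (frame (Nat.le_succ N) (1 : UnitaryGroup 𝔽 (N + 1))))) ×
            EuclideanSpace 𝔽 (Fin N) =>
          g' (fun k => (frame le_rfl 1).toLin (blockColumns q.1.1 q.2 ‖q.1.2‖ k)) :=
        hgm'.comp ((measurable_toLin_pi _).comp (continuous_blockColumns.comp
          (((continuous_fst.comp continuous_fst).prodMk continuous_snd).prodMk
            (continuous_norm.comp (continuous_snd.comp continuous_fst)))).measurable)
      exact h1.lintegral_prod_right'.lintegral_prod_right'
    have hS := stiefelVolume_succ (𝔽 := 𝔽) h
    have hS' := stiefelVolume_succ (𝔽 := 𝔽) (le_refl (N + 1))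
    rw [e1, mul_add, mul_one] at hS
    rw [e3, mul_one] at hS'
    rw [hL, e1, e2]
    change _ * ∫⁻ T : Fin N → EuclideanSpace 𝔽 (Fin N), ENNReal.ofReal (D N (colMatrix T) ^ _) *
      ∫⁻ b : perp (colSpan (frame hN (1 : UnitaryGroup 𝔽 (N + 1 + m)))), φ T ‖b‖ =
      _ * ∫⁻ T, g' T
    rw [hR, e3, mul_one]
    simp only [key]
    rw [lintegral_const_mul _ hmeas]
    rw [hS, hS', ENNReal.mul_inv (Or.inl stiefelVolume_ne_zero) (Or.inl stiefelVolume_ne_top)]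
    have hc := ENNReal.mul_inv_cancel (stiefelVolume_ne_zero (𝔽 := 𝔽) (N := N) (n := N + 1))
      stiefelVolume_ne_top
    generalize (∫⁻ T : Fin N → EuclideanSpace 𝔽 (Fin N), _) = X
    -- The volume of the `N`-frames in `𝔽^{N+1}` enters through the second reduction and cancels
    -- against the recursion for `stiefelVolume 𝔽 (N + 1) (N + 1)`.
    calc _ = (stiefelVolume 𝔽 N N)⁻¹ * stiefelVolume 𝔽 N (N + 1 + m) *
          (ENNReal.ofReal (sphereArea (β + β * m)) * (ENNReal.ofReal (sphereArea β))⁻¹ * X) *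
          (stiefelVolume 𝔽 N (N + 1) * (stiefelVolume 𝔽 N (N + 1))⁻¹) := by rw [hc, mul_one]
      _ = _ := by ring

end Induction

/-! ### From invariant functions to the linear and the affine formula. -/

section Main

set_option linter.unusedSectionVars false

/-- Translation invariance allows all other vertices to be measured from the first one. -/
theorem lintegral_cons_add {E : Type} [MeasureSpace E] [SigmaFinite (volume : Measure E)]
    [AddGroup E] [MeasurableAdd₂ E] [(volume : Measure E).IsAddLeftInvariant] {N : ℕ}
    {F : (Fin (N + 1) → E) → ℝ≥0∞} (hF : Measurable F) :
    ∫⁻ x, F x = ∫⁻ v : E, ∫⁻ y : Fin N → E,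
      F (Fin.cons (α := fun _ => E) v fun k => v + y k) := by
  have hmp := (volume_preserving_piFinSuccAbove (fun _ : Fin (N + 1) => E) 0).symm
  rw [← hmp.lintegral_comp hF, Measure.volume_eq_prod, lintegral_prod]
  · refine lintegral_congr fun v => ?_
    rw [← lintegral_add_left_eq_self _ (fun _ => v : Fin N → E)]
    refine lintegral_congr fun y => ?_
    congr 1
    simp [MeasurableEquiv.piFinSuccAbove, Fin.insertNthEquiv]
    rfl
  · exact (hF.comp hmp.measurable).aemeasurable

theorem measurable_cons_add {E : Type} [MeasurableSpace E] [Add E] [MeasurableAdd₂ E] {N : ℕ} :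
    Measurable fun p : E × (Fin N → E) =>
      (Fin.cons (α := fun _ => E) p.1 fun k => p.1 + p.2 k : Fin (N + 1) → E) := by
  refine measurable_pi_lambda _ fun i => ?_
  refine Fin.cases ?_ (fun i => ?_) i
  · simpa using measurable_fst
  · have h : Measurable fun p : E × (Fin N → E) => p.1 + p.2 i := by fun_prop
    simpa using h

variable {𝔽 : Type} [NormedDivisionRing 𝔽] [StarRing 𝔽] [InnerProductSpace ℝ 𝔽]
  [SMulCommClass ℝ 𝔽 𝔽] [IsScalarTower ℝ 𝔽 𝔽] [FiniteDimensional ℝ 𝔽] [ContinuousStar 𝔽]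
  [NormedStar 𝔽] [SecondCountableTopology 𝔽] [MeasurableSpace 𝔽] [BorelSpace 𝔽]

theorem measurable_uncurry_toLin_pi {N n k : ℕ} :
    Measurable fun (p : Stiefel 𝔽 N n × (Fin k → EuclideanSpace 𝔽 (Fin N))) i =>
      p.1.toLin (p.2 i) :=
  measurable_pi_lambda _ fun i => (continuous_toLin.measurable).comp
    (measurable_fst.prodMk ((measurable_pi_apply i).comp measurable_snd))

theorem measurable_frame_pi {N n k : ℕ} (h : N ≤ n)
    {g : (Fin k → EuclideanSpace 𝔽 (Fin n)) → ℝ≥0∞} (hg : Measurable g) :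
    Measurable fun p : UnitaryGroup 𝔽 n × (Fin k → EuclideanSpace 𝔽 (Fin N)) =>
      g fun i => (frame h p.1).toLin (p.2 i) :=
  hg.comp (measurable_uncurry_toLin_pi.comp
    (((continuous_frame h).measurable.comp measurable_fst).prodMk measurable_snd))

/-- The average of a function over the unitary group. -/
noncomputable def unitaryAverage {n k : ℕ} (g : (Fin k → EuclideanSpace 𝔽 (Fin n)) → ℝ≥0∞)
    (x : Fin k → EuclideanSpace 𝔽 (Fin n)) : ℝ≥0∞ :=
  ∫⁻ U : UnitaryGroup 𝔽 n, g (fun i => (frame le_rfl U).toLin (x i))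
    ∂(Measure.haarMeasure (⊤ : TopologicalSpace.PositiveCompacts (UnitaryGroup 𝔽 n)))

theorem measurable_unitaryAverage {n k : ℕ} {g : (Fin k → EuclideanSpace 𝔽 (Fin n)) → ℝ≥0∞}
    (hg : Measurable g) : Measurable (unitaryAverage g) :=
  (measurable_frame_pi le_rfl hg).lintegral_prod_left'

/-- Rotating the argument multiplies the averaging variable on the right, so right invariance of
Haar measure is what is needed. -/
theorem isUnitaryInvariant_unitaryAverage {n k : ℕ}
    (g : (Fin k → EuclideanSpace 𝔽 (Fin n)) → ℝ≥0∞) : IsUnitaryInvariant (unitaryAverage g) := by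
  intro A x
  obtain ⟨V, rfl⟩ := exists_frame_eq A
  simp only [unitaryAverage, ← toLin_frame_mul]
  exact lintegral_mul_right_eq_self
    (fun U : UnitaryGroup 𝔽 n => g fun i => (frame le_rfl U).toLin (x i)) V

theorem lintegral_unitaryAverage {n k : ℕ} {g : (Fin k → EuclideanSpace 𝔽 (Fin n)) → ℝ≥0∞}
    (hg : Measurable g) : ∫⁻ x, unitaryAverage g x = ∫⁻ x, g x := by
  have h : ∀ U : UnitaryGroup 𝔽 n, ∫⁻ x : Fin k → EuclideanSpace 𝔽 (Fin n),
      g (fun i => (frame le_rfl U).toLin (x i)) = ∫⁻ x, g x := fun U =>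
    (measurePreserving_toLin_pi (frame le_rfl U) k).lintegral_comp hg
  simp only [unitaryAverage]
  rw [← lintegral_lintegral_swap (measurable_frame_pi le_rfl hg).aemeasurable]
  simp only [h, lintegral_const, measure_univ, mul_one]

/-- The linear Blaschke-Petkantschin formula. -/
theorem lintegral_eq_lintegral_frame {D : ∀ N, Matrix (Fin N) (Fin N) 𝔽 → ℝ} (hD : IsAbsDet D)
    {N n : ℕ} (h : N ≤ n) {g : (Fin N → EuclideanSpace 𝔽 (Fin n)) → ℝ≥0∞} (hg : Measurable g) :
    ∫⁻ x, g x = (stiefelVolume 𝔽 N N)⁻¹ * stiefelVolume 𝔽 N n *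
      ∫⁻ U : UnitaryGroup 𝔽 n, ∫⁻ T : Fin N → EuclideanSpace 𝔽 (Fin N),
        ENNReal.ofReal (D N (colMatrix T) ^ (Module.finrank ℝ 𝔽 * (n - N))) *
          g (fun k => (frame h U).toLin (T k)) ∂volume
        ∂(Measure.haarMeasure (⊤ : TopologicalSpace.PositiveCompacts (UnitaryGroup 𝔽 n))) := by
  have hmeas : Measurable fun p : UnitaryGroup 𝔽 n × (Fin N → EuclideanSpace 𝔽 (Fin N)) =>
      ENNReal.ofReal (D N (colMatrix p.2) ^ (Module.finrank ℝ 𝔽 * (n - N))) *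
        g fun i => (frame h p.1).toLin (p.2 i) :=
    ((hD.measurable _ _).comp measurable_snd).mul (measurable_frame_pi h hg)
  rw [← lintegral_unitaryAverage hg, lintegral_of_isUnitaryInvariant hD N h _
    (measurable_unitaryAverage hg) (isUnitaryInvariant_unitaryAverage g),
    lintegral_lintegral_swap hmeas.aemeasurable]
  congr 1
  refine lintegral_congr fun T => ?_
  rw [lintegral_const_mul' _ _ ENNReal.ofReal_ne_top]
  -- Rotating the standard frame by `U` gives the first `N` columns of `U`, so the average becomes
  -- the integral over frames.
  simp only [unitaryAverage, ← toLin_frame_mul, mul_one]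

/-- The weight depends only on the edges `y`, while `w₀` and `r` together parametrise the first
vertex `v = A w₀ + r`. The double integral over them is therefore a single integral over `𝔽^n`. -/
theorem lintegral_perp_diffMatrix {D : ∀ N, Matrix (Fin N) (Fin N) 𝔽 → ℝ} (hD : IsAbsDet D)
    {N n : ℕ} (p : ℕ) {f : (Fin (N + 1) → EuclideanSpace 𝔽 (Fin n)) → ℝ≥0∞} (hf : Measurable f)
    (A : Stiefel 𝔽 N n) :
    ∫⁻ r : perp (colSpan A), ∫⁻ w : Fin (N + 1) → EuclideanSpace 𝔽 (Fin N),
        ENNReal.ofReal (D N (diffMatrix w) ^ p) * f (fun k => A.toLin (w k) + r) =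
      ∫⁻ y : Fin N → EuclideanSpace 𝔽 (Fin N), ENNReal.ofReal (D N (colMatrix y) ^ p) *
        ∫⁻ v, f (Fin.cons (α := fun _ => EuclideanSpace 𝔽 (Fin n)) v
          fun k => v + A.toLin (y k)) := by
  have hmeas : Measurable fun q : EuclideanSpace 𝔽 (Fin n) × (Fin N → EuclideanSpace 𝔽 (Fin N)) =>
      ENNReal.ofReal (D N (colMatrix q.2) ^ p) *
        f (Fin.cons (α := fun _ => EuclideanSpace 𝔽 (Fin n)) q.1 fun k => q.1 + A.toLin (q.2 k)) :=
    ((hD.measurable _ _).comp measurable_snd).mul (hf.comp (measurable_cons_add.comp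
      (measurable_fst.prodMk ((measurable_toLin_pi A).comp measurable_snd))))
  have h1 : ∀ r : perp (colSpan A), ∫⁻ w : Fin (N + 1) → EuclideanSpace 𝔽 (Fin N),
      ENNReal.ofReal (D N (diffMatrix w) ^ p) * f (fun k => A.toLin (w k) + r) =
      ∫⁻ w : EuclideanSpace 𝔽 (Fin N), ∫⁻ y : Fin N → EuclideanSpace 𝔽 (Fin N),
        ENNReal.ofReal (D N (colMatrix y) ^ p) *
          f (Fin.cons (α := fun _ => EuclideanSpace 𝔽 (Fin n)) (A.toLin w + r)
            fun k => A.toLin w + r + A.toLin (y k)) := by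
    intro r
    rw [lintegral_cons_add]
    · refine lintegral_congr fun w => lintegral_congr fun y => ?_
      congr 3
      · congr 1
        ext i k
        simp [diffMatrix, colMatrix]
      · ext1 k
        refine Fin.cases ?_ (fun k => ?_) k
        · simp
        · simp [add_right_comm]
    · have hd : Measurable fun w : Fin (N + 1) → EuclideanSpace 𝔽 (Fin N) =>
          ENNReal.ofReal (D N (diffMatrix w) ^ p) := by
        have : Measurable fun (w : Fin (N + 1) → EuclideanSpace 𝔽 (Fin N)) (k : Fin N) =>
            w k.succ - w 0 := by fun_prop
        exact (hD.measurable N p).comp this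
      refine hd.mul (hf.comp (measurable_pi_lambda _ fun k => ?_))
      exact ((measurable_toLin A).comp (measurable_pi_apply k)).add_const _
  simp only [h1]
  rw [← lintegral_eq_lintegral_perp A hmeas.lintegral_prod_right',
    lintegral_lintegral_swap hmeas.aemeasurable]
  exact lintegral_congr fun y => lintegral_const_mul' (ENNReal.ofReal (D N (colMatrix y) ^ p))
    (fun v => f (Fin.cons (α := fun _ => EuclideanSpace 𝔽 (Fin n)) v fun k => v + A.toLin (y k)))
    ENNReal.ofReal_ne_top

/-- The affine Blaschke-Petkantschin formula. -/
theorem affine_blaschkePetkantschin {D : ∀ N, Matrix (Fin N) (Fin N) 𝔽 → ℝ} (hD : IsAbsDet D)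
    {N n : ℕ} (h : N ≤ n) (B : Grassmannian 𝔽 N n → Stiefel 𝔽 N n) (hB : IsBasisChoice B)
    (f : (Fin (N + 1) → EuclideanSpace 𝔽 (Fin n)) → ℝ≥0∞) (hf : Measurable f) :
    ∫⁻ v, f v = ∫⁻ L, (∫⁻ r : perp L, ∫⁻ w : Fin (N + 1) → EuclideanSpace 𝔽 (Fin N),
        ENNReal.ofReal (D N (diffMatrix w) ^ (Module.finrank ℝ 𝔽 * (n - N))) *
          f (fun k => (B L).toLin (w k) + r)) ∂(grassmannMeasure 𝔽 h) := by
  set p := Module.finrank ℝ 𝔽 * (n - N)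
  set g : (Fin N → EuclideanSpace 𝔽 (Fin n)) → ℝ≥0∞ := fun x =>
    ∫⁻ v, f (Fin.cons (α := fun _ => EuclideanSpace 𝔽 (Fin n)) v fun k => v + x k) with hg
  have hgm : Measurable g := (hf.comp measurable_cons_add).lintegral_prod_left'
  set J : Stiefel 𝔽 N n → ℝ≥0∞ := fun A => ∫⁻ y : Fin N → EuclideanSpace 𝔽 (Fin N),
    ENNReal.ofReal (D N (colMatrix y) ^ p) * g (fun k => A.toLin (y k)) with hJ
  have hJint : Measurable fun q : Stiefel 𝔽 N n × (Fin N → EuclideanSpace 𝔽 (Fin N)) =>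
      ENNReal.ofReal (D N (colMatrix q.2) ^ p) * g (fun k => q.1.toLin (q.2 k)) :=
    ((hD.measurable _ _).comp measurable_snd).mul (hgm.comp measurable_uncurry_toLin_pi)
  have hJm : Measurable J := hJint.lintegral_prod_right'
  -- Two bases of the same subspace differ by a unitary `V` of `𝔽^N`, which preserves both Lebesgue
  -- measure and the determinant weight.
  have hJcol : ∀ A A', colSpan A = colSpan A' → J A = J A' := by
    intro A A' hA
    obtain ⟨V, rfl⟩ := exists_comp_eq_of_colSpan_eq hA
    simp only [hJ, Stiefel.toLin_comp]
    refine ((measurePreserving_toLin_pi V N).lintegral_comp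
      (hJint.comp measurable_prodMk_left)).symm.trans (lintegral_congr fun y => ?_)
    simp only [Function.comp_apply, hD.colMatrix_toLin]
  have hinner : ∀ L, (∫⁻ r : perp L, ∫⁻ w : Fin (N + 1) → EuclideanSpace 𝔽 (Fin N),
      ENNReal.ofReal (D N (diffMatrix w) ^ p) * f (fun k => (B L).toLin (w k) + r)) = J (B L) := by
    intro L
    have key : ∀ A, colSpan A = L → (∫⁻ r : perp L, ∫⁻ w : Fin (N + 1) → EuclideanSpace 𝔽 (Fin N),
        ENNReal.ofReal (D N (diffMatrix w) ^ p) * f (fun k => A.toLin (w k) + r)) = J A := by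
      rintro A rfl
      exact lintegral_perp_diffMatrix hD p hf A
    exact key _ (hB L)
  have hcol : Measurable (colSpan : Stiefel 𝔽 N n → Grassmannian 𝔽 N n) := fun _ hs => hs
  have hJB : (fun L => J (B L)) ∘ colSpan = J := by
    ext A
    exact hJcol _ _ (hB _)
  -- `B` itself need not be measurable: the Grassmannian carries the quotient `σ`-algebra, and
  -- composing with `colSpan` gives back the measurable `J`.
  have hJBm : Measurable fun L => J (B L) := fun s hs => by
    change MeasurableSet (colSpan ⁻¹' ((fun L => J (B L)) ⁻¹' s))
    rw [← Set.preimage_comp, hJB]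
    exact hJm hs
  simp only [hinner]
  rw [grassmannMeasure, lintegral_smul_measure, lintegral_map hJBm hcol]
  change _ = _ • ∫⁻ A, ((fun L => J (B L)) ∘ colSpan) A ∂_
  rw [hJB, stiefelMeasure, lintegral_smul_measure,
    lintegral_map hJm (continuous_frame h).measurable, lintegral_cons_add hf, smul_eq_mul,
    smul_eq_mul, ← mul_assoc]
  -- Integrating the base vertex first turns the left side into the integral of `g` over the edges,
  -- where the linear formula applies.
  refine (lintegral_lintegral_swap (f := fun v (x : Fin N → EuclideanSpace 𝔽 (Fin n)) =>
    f (Fin.cons (α := fun _ => EuclideanSpace 𝔽 (Fin n)) v fun k => v + x k))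
    (hf.comp measurable_cons_add).aemeasurable).trans ?_
  exact lintegral_eq_lintegral_frame hD h hgm

end Main

/-! ### The modulus of the determinant over `ℝ`, `ℂ` and `ℍ`. -/

section AbsDet

theorem norm_det_of_conjTranspose_mul_self {𝕜 ι : Type*} [NormedField 𝕜] [StarRing 𝕜]
    [NormedStarGroup 𝕜] [Fintype ι] [DecidableEq ι] {U : Matrix ι ι 𝕜} (hU : Uᴴ * U = 1) :
    ‖U.det‖ = 1 := by
  have h := congrArg (fun M => ‖M.det‖) hU
  simp only [Matrix.det_mul, Matrix.det_conjTranspose, norm_mul, norm_star, Matrix.det_one,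
    norm_one, ← sq] at h
  exact (pow_eq_one_iff_of_nonneg (norm_nonneg _) two_ne_zero).1 h

theorem isAbsDet_norm_det {𝔽 : Type} [NormedField 𝔽] [StarRing 𝔽] [InnerProductSpace ℝ 𝔽]
    [SMulCommClass ℝ 𝔽 𝔽] [IsScalarTower ℝ 𝔽 𝔽] [NormedStarGroup 𝔽] :
    IsAbsDet (𝔽 := 𝔽) fun _ M => ‖M.det‖ where
  nonneg _ _ := norm_nonneg _
  continuous _ := (Continuous.matrix_det continuous_id).norm
  zero_dim M := by simp
  unitary_mul N U M hU := by
    rw [Matrix.det_mul, norm_mul, norm_det_of_conjTranspose_mul_self hU, one_mul]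
  block N M t ht h0 hlast := by
    -- Only the corner term survives the expansion along the last row.
    rw [Matrix.det_succ_row M (Fin.last N), Fin.sum_univ_castSucc]
    simp [h0, hlast, norm_smul, abs_of_nonneg ht, Fin.succAbove_last, mul_comm]

/-- `quaternionBlock` is additive. -/
def quaternionBlockHom : ℍ[ℝ] →+ Matrix (Fin 2) (Fin 2) ℂ where
  toFun := quaternionBlock
  map_zero' := by
    ext i j
    fin_cases i <;> fin_cases j <;> apply Complex.ext <;> simp [quaternionBlock]
  map_add' p q := by
    ext i j
    fin_cases i <;> fin_cases j <;> apply Complex.ext <;> simp [quaternionBlock] <;> ring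

theorem quaternionBlock_mul (p q : ℍ[ℝ]) :
    quaternionBlock (p * q) = quaternionBlock p * quaternionBlock q := by
  ext i j
  fin_cases i <;> fin_cases j <;> apply Complex.ext <;>
    simp [quaternionBlock, Matrix.mul_apply] <;> ring

theorem quaternionBlock_star (q : ℍ[ℝ]) : quaternionBlock (star q) = (quaternionBlock q)ᴴ := by
  ext i j
  fin_cases i <;> fin_cases j <;> apply Complex.ext <;> simp [quaternionBlock]

theorem quaternionBlock_real_smul_one (t : ℝ) :
    quaternionBlock (t • 1) = (t : ℂ) • (1 : Matrix (Fin 2) (Fin 2) ℂ) := by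
  ext i j
  fin_cases i <;> fin_cases j <;> apply Complex.ext <;> simp [quaternionBlock]

theorem continuous_quaternionBlock : Continuous quaternionBlock := by
  have h1 : ∀ f : ℍ[ℝ] → ℝ, Continuous f → ∀ g : ℍ[ℝ] → ℝ, Continuous g →
      Continuous fun q => (⟨f q, g q⟩ : ℂ) := fun f hf g hg => by
    have : (fun q => (⟨f q, g q⟩ : ℂ)) = fun q => (f q : ℂ) + (g q : ℂ) * Complex.I := by
      ext q
      simp [Complex.mk_eq_add_mul_I]
    rw [this]
    fun_prop
  have hz := h1 _ Quaternion.continuous_re _ Quaternion.continuous_imI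
  have hw := h1 _ Quaternion.continuous_imJ _ Quaternion.continuous_imK
  refine continuous_matrix fun i j => ?_
  fin_cases i <;> fin_cases j
  · exact hz
  · exact hw
  · exact hw.star.neg
  · exact hz.star

theorem complexRep_mul {N : ℕ} (A B : Matrix (Fin N) (Fin N) ℍ[ℝ]) :
    complexRep (A * B) = complexRep A * complexRep B := by
  ext ⟨i, a⟩ ⟨j, b⟩
  have h : quaternionBlock ((A * B) i j) =
      ∑ k, quaternionBlock (A i k) * quaternionBlock (B k j) := by
    rw [Matrix.mul_apply]
    refine (map_sum quaternionBlockHom _ _).trans (Finset.sum_congr rfl fun k _ => ?_)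
    exact quaternionBlock_mul _ _
  change quaternionBlock ((A * B) i j) a b = _
  rw [h]
  simp only [complexRep, Matrix.of_apply, Matrix.mul_apply, Matrix.sum_apply,
    Fintype.sum_prod_type]

theorem complexRep_conjTranspose {N : ℕ} (A : Matrix (Fin N) (Fin N) ℍ[ℝ]) :
    complexRep Aᴴ = (complexRep A)ᴴ := by
  ext ⟨i, a⟩ ⟨j, b⟩
  simp [complexRep, quaternionBlock_star]

theorem complexRep_one {N : ℕ} : complexRep (1 : Matrix (Fin N) (Fin N) ℍ[ℝ]) = 1 := by
  have h1 : quaternionBlock 1 = 1 := by simpa using quaternionBlock_real_smul_one 1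
  have h0 : quaternionBlock 0 = 0 := map_zero quaternionBlockHom
  ext ⟨i, a⟩ ⟨j, b⟩
  by_cases h : i = j
  · subst h
    simp [complexRep, h1, Matrix.one_apply]
  · simp [complexRep, h0, Matrix.one_apply, h]

/-- Each quaternion row gives two complex rows, so after reindexing the matrix is block triangular
with corner `t I₂` of determinant `t ^ 2`. The square root in `quaternionAbsDet` brings this back to
`t`. -/
theorem norm_det_complexRep_block {N : ℕ} (M : Matrix (Fin (N + 1)) (Fin (N + 1)) ℍ[ℝ]) (t : ℝ)
    (h0 : ∀ j : Fin N, M (Fin.last N) j.castSucc = 0) (hlast : M (Fin.last N) (Fin.last N) = t • 1) :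
    ‖(complexRep M).det‖ = ‖(complexRep (M.submatrix Fin.castSucc Fin.castSucc)).det‖ * t ^ 2 := by
  let e : (Fin N × Fin 2) ⊕ Fin 2 ≃ Fin (N + 1) × Fin 2 :=
    { toFun := Sum.elim (fun p => (p.1.castSucc, p.2)) fun a => (Fin.last N, a)
      invFun := fun p => Fin.lastCases (motive := fun _ => (Fin N × Fin 2) ⊕ Fin 2)
        (Sum.inr p.2) (fun i => Sum.inl (i, p.2)) p.1
      left_inv := by rintro (⟨i, a⟩ | a) <;> simp
      right_inv := by
        rintro ⟨i, a⟩
        refine Fin.lastCases ?_ (fun i => ?_) i <;> simp }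
  have hz : quaternionBlock 0 = 0 := map_zero quaternionBlockHom
  have hblock : (complexRep M).submatrix e e = Matrix.fromBlocks
      (complexRep (M.submatrix Fin.castSucc Fin.castSucc))
      (Matrix.of fun p b => complexRep M (p.1.castSucc, p.2) (Fin.last N, b)) 0
      ((t : ℂ) • (1 : Matrix (Fin 2) (Fin 2) ℂ)) := by
    ext (⟨i, a⟩ | a) (⟨j, b⟩ | b)
    · rfl
    · rfl
    · simp [e, complexRep, h0, hz]
    · simp [e, complexRep, hlast, quaternionBlock_real_smul_one]
  rw [← Matrix.det_submatrix_equiv_self e, hblock, Matrix.det_fromBlocks_zero₂₁, norm_mul,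
    Matrix.det_smul]
  simp

theorem isAbsDet_quaternionAbsDet : IsAbsDet (𝔽 := ℍ[ℝ]) fun _ M => quaternionAbsDet M where
  nonneg _ _ := Real.sqrt_nonneg _
  continuous N := by
    have h : Continuous fun M : Matrix (Fin N) (Fin N) ℍ[ℝ] => complexRep M :=
      continuous_matrix fun p q => (continuous_quaternionBlock.comp
        (continuous_id.matrix_elem p.1 q.1)).matrix_elem p.2 q.2
    exact h.matrix_det.norm.sqrt
  zero_dim M := by simp [quaternionAbsDet]
  unitary_mul N U M hU := by
    have h : (complexRep U)ᴴ * complexRep U = 1 := by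
      rw [← complexRep_conjTranspose, ← complexRep_mul, hU, complexRep_one]
    simp only [quaternionAbsDet]
    rw [complexRep_mul, Matrix.det_mul, norm_mul, norm_det_of_conjTranspose_mul_self h, one_mul]
  block N M t ht h0 hlast := by
    simp only [quaternionAbsDet]
    rw [norm_det_complexRep_block M t h0 hlast, Real.sqrt_mul (norm_nonneg _), Real.sqrt_sq ht]

end AbsDet

end BlaschkePetkantschin


theorem mainTheorem3 (N n : ℕ) (h : N ≤ n) :
    (∀ B : Grassmannian ℝ N n → Stiefel ℝ N n,
      IsBasisChoice B →
      ∀ f : (Fin (N + 1) → EuclideanSpace ℝ (Fin n)) → ℝ≥0∞, Measurable f →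
        ∫⁻ v, f v =
          ∫⁻ L, (∫⁻ r : perp L,
            ∫⁻ w : Fin (N + 1) → EuclideanSpace ℝ (Fin N),
              ENNReal.ofReal (|(diffMatrix w).det| ^ (1 * (n - N))) *
                f (fun k => (B L).toLin (w k) + r))
          ∂(grassmannMeasure ℝ h)) ∧
    (∀ B : Grassmannian ℂ N n → Stiefel ℂ N n,
      IsBasisChoice B →
      ∀ f : (Fin (N + 1) → EuclideanSpace ℂ (Fin n)) → ℝ≥0∞, Measurable f →
        ∫⁻ v, f v =
          ∫⁻ L, (∫⁻ r : perp L,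
            ∫⁻ w : Fin (N + 1) → EuclideanSpace ℂ (Fin N),
              ENNReal.ofReal (‖(diffMatrix w).det‖ ^ (2 * (n - N))) *
                f (fun k => (B L).toLin (w k) + r))
          ∂(grassmannMeasure ℂ h)) ∧
    (∀ B : Grassmannian ℍ[ℝ] N n → Stiefel ℍ[ℝ] N n,
      IsBasisChoice B →
      ∀ f : (Fin (N + 1) → EuclideanSpace ℍ[ℝ] (Fin n)) → ℝ≥0∞, Measurable f →
        ∫⁻ v, f v =
          ∫⁻ L, (∫⁻ r : perp L,
            ∫⁻ w : Fin (N + 1) → EuclideanSpace ℍ[ℝ] (Fin N),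
              ENNReal.ofReal (quaternionAbsDet
                  (diffMatrix w) ^ (4 * (n - N))) *
                f (fun k => (B L).toLin (w k) + r))
          ∂(grassmannMeasure ℍ[ℝ] h)) := by
  refine ⟨fun B hB f hf => ?_, fun B hB f hf => ?_, fun B hB f hf => ?_⟩
  · rw [affine_blaschkePetkantschin isAbsDet_norm_det h B hB f hf, Module.finrank_self]
    rfl
  · rw [affine_blaschkePetkantschin isAbsDet_norm_det h B hB f hf, Complex.finrank_real_complex]
  · rw [affine_blaschkePetkantschin isAbsDet_quaternionAbsDet h B hB f hf,
      Quaternion.finrank_eq_four]
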